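/- Let $H_3(\mathbb R)$ be the Heisenberg group of real upper unitriangular $3\times 3$ matrices, $H_3(\mathbb Z)$ the lattice of its integer matrices, and $\mathfrak h_3(\mathbb R)$ its Lie algebra of strictly upper triangular real $3\times3$ matrices. Let $P(\mathfrak h_3(\mathbb R))$ be the set of lines through $0$ in $\mathfrak h_3(\mathbb R)$, on which $H_3(\mathbb R)$ acts through the adjoint action $g\cdot v=gvg^{-1}$; for a line $\theta$ put $\exp(\theta)=\{\exp(v): v\in\theta\}$. For $t\in\mathbb R$ let $\theta_t$ be the line through $\begin{pmatrix}0&1&t\\0&0&0\\0&0&0\end{pmatrix}$ and let $\theta_\infty$ be the line through $\begin{pmatrix}0&0&1\\0&0&0\\0&0&0\end{pmatrix}$. Let $\mathrm{dist}$ be a right-invariant metric on $H_3(\mathbb R)$ compatible with its topology. A measure preserving action $T=(T_\gamma)$ of $H_3(\mathbb Z)$ on a $\sigma$-finite standard measure space $(X,\mu)$ is called *recurrent along* $\theta\in P(\mathfrak h_3(\mathbb R))$ if for every $\epsilon>0$ and every measurable $A\subset X$ with $\mu(A)>0$ there are $\gamma\in H_3(\mathbb Z)\setminus\{1\}$ and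 $g\in\exp(\theta)$ with $\mathrm{dist}(\gamma,g)<\epsilon$ and $\mu(A\cap T_\gamma A)>0$; it is called *evenly recurrent along* $\theta$ if it is recurrent along every line in the $H_3(\mathbb R)$-orbit of $\theta$. Let $\mathcal R(T)$ and $\mathcal{ER}(T)$ be the sets of lines along which $T$ is recurrent and evenly recurrent, respectively. The action $T$ has *rank one* if there are measurable sets $B_n\subset X$ with $0<\mu(B_n)<\infty$ and a (left) Følner sequence $(F_n)$ of finite subsets of $H_3(\mathbb Z)$ such that for every $n$ the sets $T_fB_n$, $f\in F_n$, are pairwise disjoint, and for every measurable $A$ with $\mu(A)<\infty$ there are $S_n\subset F_n$ with $\mu\big(A\,\triangle\,\bigcup_{f\in S_n}T_fB_n\big)\to 0$ as $n\to\infty$. **Theorem.** There are a standard Borel space $X$ with a $\sigma$-finite measure $\mu$, $\mu(X)=\infty$, and a free (that is, $T_\gamma x\ne x$ for all $x\in X$ and $\gamma\ne1$), rank-one, $\mu$-preserving action $T$ of $H_3(\mathbb Z)$ on $(X,\mu)$ such that, for every choice of $\mathrm{dist}$, $$\mathcal R(T)=\{\theta_l: l\in\mathbb Z\}\cup\{\theta_\infty\}.$$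 Moreover $\mathcal{ER}(T)=\{\theta_\infty\}$, and hence $\mathcal R(T)\neq\mathcal{ER}(T)$. -/

import Mathlib

open MeasureTheory Filter Topology
open scoped Pointwise symmDiff ENNReal LinearAlgebra.Projectivization

noncomputable section

namespace Heisenberg

/-- The real matrix with `x`, `y` next to the diagonal, `z` in the corner, and constant diagonal
`e`. For `e = 1` this is an element of `H₃(ℝ)`, for `e = 0` an element of its Lie algebra. -/
abbrev upper (e x y z : ℝ) : Matrix (Fin 3) (Fin 3) ℝ :=
  !![e, x, z; 0, e, y; 0, 0, e]

theorem upper_mul (e x y z e' x' y' z' : ℝ) :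
    upper e x y z * upper e' x' y' z' =
      upper (e * e') (e * x' + x * e') (e * y' + y * e') (e * z' + x * y' + z * e') := by
  ext i j
  fin_cases i <;> fin_cases j <;> simp [upper, Matrix.mul_apply, Fin.sum_univ_three]

theorem adjugate_upper (x y z : ℝ) :
    (upper 1 x y z).adjugate = upper 1 (-x) (-y) (x * y - z) := by
  rw [upper, Matrix.adjugate_fin_three_of]
  ext i j
  fin_cases i <;> fin_cases j <;> simp [upper]

/-- The Heisenberg group `H₃(ℝ)` of upper unitriangular real `3 × 3` matrices. -/
def H3R : Subgroup (Matrix.SpecialLinearGroup (Fin 3) ℝ) where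
  carrier := {g | ∃ x y z : ℝ, (g : Matrix (Fin 3) (Fin 3) ℝ) = upper 1 x y z}
  one_mem' := ⟨0, 0, 0, by
    ext i j
    fin_cases i <;> fin_cases j <;> simp [upper]⟩
  mul_mem' := by
    rintro g h ⟨x, y, z, hg⟩ ⟨x', y', z', hh⟩
    refine ⟨x' + x, y' + y, z' + x * y' + z, ?_⟩
    rw [Matrix.SpecialLinearGroup.coe_mul, hg, hh, upper_mul]
    simp
  inv_mem' := by
    rintro g ⟨x, y, z, hg⟩
    refine ⟨-x, -y, x * y - z, ?_⟩
    rw [Matrix.SpecialLinearGroup.coe_inv, hg, adjugate_upper]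

/-- The underlying matrix of an element of `H₃(ℝ)`. -/
def H3R.mat (g : H3R) : Matrix (Fin 3) (Fin 3) ℝ := (g : Matrix.SpecialLinearGroup (Fin 3) ℝ)

theorem H3R.mat_one : H3R.mat 1 = 1 := by simp [H3R.mat]

theorem H3R.mat_mul (g h : H3R) : H3R.mat (g * h) = H3R.mat g * H3R.mat h := by simp [H3R.mat]

theorem H3R.mat_inv (g : H3R) : H3R.mat g⁻¹ = (H3R.mat g).adjugate := by
  simp [H3R.mat, Matrix.SpecialLinearGroup.coe_inv]

/-- The lattice `H₃(ℤ)` of integer matrices in `H₃(ℝ)`. -/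
def H3Z : Subgroup H3R where
  carrier := {g | ∃ n₁ n₂ n₃ : ℤ, H3R.mat g = upper 1 n₁ n₂ n₃}
  one_mem' := ⟨0, 0, 0, by
    rw [H3R.mat_one]
    ext i j
    fin_cases i <;> fin_cases j <;> simp [upper]⟩
  mul_mem' := by
    rintro g h ⟨x, y, z, hg⟩ ⟨x', y', z', hh⟩
    refine ⟨x' + x, y' + y, z' + x * y' + z, ?_⟩
    rw [H3R.mat_mul, hg, hh, upper_mul]
    simp
  inv_mem' := by
    rintro g ⟨x, y, z, hg⟩
    refine ⟨-x, -y, x * y - z, ?_⟩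
    rw [H3R.mat_inv, hg, adjugate_upper]
    simp

/-- The Lie algebra `𝔥₃(ℝ)` of strictly upper triangular real `3 × 3` matrices (as a
vector space; it is closed under the commutator bracket). -/
def h3 : Submodule ℝ (Matrix (Fin 3) (Fin 3) ℝ) where
  carrier := {v | ∃ x y z : ℝ, v = upper 0 x y z}
  zero_mem' := ⟨0, 0, 0, by
    ext i j
    fin_cases i <;> fin_cases j <;> simp [upper]⟩
  add_mem' := by
    rintro v w ⟨x, y, z, rfl⟩ ⟨x', y', z', rfl⟩
    refine ⟨x + x', y + y', z + z', ?_⟩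
    ext i j
    fin_cases i <;> fin_cases j <;> simp [upper]
  smul_mem' := by
    rintro c v ⟨x, y, z, rfl⟩
    refine ⟨c * x, c * y, c * z, ?_⟩
    ext i j
    fin_cases i <;> fin_cases j <;> simp [upper]

theorem conj_mem_h3 (g : H3R) (v : h3) :
    H3R.mat g * (v : Matrix (Fin 3) (Fin 3) ℝ) * H3R.mat g⁻¹ ∈ h3 := by
  obtain ⟨x, y, z, hg⟩ := g.2
  obtain ⟨α, β, γ, hv⟩ := v.2
  have hg' : H3R.mat g = upper 1 x y z := hg
  refine ⟨α, β, γ + x * β - y * α, ?_⟩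
  rw [H3R.mat_inv, hg', hv, adjugate_upper, upper_mul, upper_mul]
  ext i j
  fin_cases i <;> fin_cases j <;> simp [upper]
  ring

/-- The adjoint action `g · v = g v g⁻¹` of `H₃(ℝ)` on its Lie algebra. -/
instance adjointAction : DistribMulAction H3R h3 where
  smul g v := ⟨H3R.mat g * (v : Matrix (Fin 3) (Fin 3) ℝ) * H3R.mat g⁻¹, conj_mem_h3 g v⟩
  one_smul v := Subtype.ext <| by
    change H3R.mat 1 * (v : Matrix (Fin 3) (Fin 3) ℝ) * H3R.mat 1⁻¹ = v
    simp [H3R.mat_one]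
  mul_smul g h v := Subtype.ext <| by
    change H3R.mat (g * h) * (v : Matrix (Fin 3) (Fin 3) ℝ) * H3R.mat (g * h)⁻¹ =
      H3R.mat g * (H3R.mat h * (v : Matrix (Fin 3) (Fin 3) ℝ) * H3R.mat h⁻¹) * H3R.mat g⁻¹
    rw [mul_inv_rev, H3R.mat_mul, H3R.mat_mul]
    simp only [mul_assoc]
  smul_zero g := Subtype.ext <| by
    change H3R.mat g * (0 : Matrix (Fin 3) (Fin 3) ℝ) * H3R.mat g⁻¹ = 0
    simp
  smul_add g v w := Subtype.ext <| by
    change H3R.mat g * ((v : Matrix (Fin 3) (Fin 3) ℝ) + w) * H3R.mat g⁻¹ =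
      H3R.mat g * (v : Matrix (Fin 3) (Fin 3) ℝ) * H3R.mat g⁻¹ +
        H3R.mat g * (w : Matrix (Fin 3) (Fin 3) ℝ) * H3R.mat g⁻¹
    rw [mul_add, add_mul]

instance : SMulCommClass H3R ℝ h3 where
  smul_comm g c v := Subtype.ext <| by
    change H3R.mat g * (c • (v : Matrix (Fin 3) (Fin 3) ℝ)) * H3R.mat g⁻¹ =
      c • (H3R.mat g * (v : Matrix (Fin 3) (Fin 3) ℝ) * H3R.mat g⁻¹)
    rw [mul_smul_comm, smul_mul_assoc]

/-- The one-parameter subgroup `exp(θ) = {exp(v) | v ∈ θ}` of `H₃(ℝ)` given by a line `θ` in the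
Lie algebra. The group `H₃(ℝ)` acts on the set `ℙ ℝ h3` of these lines through `adjointAction`. -/
def expLine (θ : ℙ ℝ h3) : Set H3R :=
  {g | ∃ v ∈ θ.submodule, H3R.mat g = NormedSpace.exp (v : Matrix (Fin 3) (Fin 3) ℝ)}

/-- The line through the matrix with entries `1`, `t` in positions `(1,2)`, `(1,3)`. -/
def thetaLine (t : ℝ) : ℙ ℝ h3 :=
  Projectivization.mk ℝ (⟨upper 0 1 0 t, 1, 0, t, rfl⟩ : h3) fun h => by
    simpa [upper] using congrFun (congrFun (congrArg Subtype.val h) 0) 1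

/-- The line through the matrix with entry `1` in position `(1,3)`. -/
def thetaInf : ℙ ℝ h3 :=
  Projectivization.mk ℝ (⟨upper 0 0 0 1, 0, 0, 1, rfl⟩ : h3) fun h => by
    simpa [upper] using congrFun (congrFun (congrArg Subtype.val h) 0) 2

/-- `m` is a right-invariant metric on `H₃(ℝ)` compatible with the topology of `H₃(ℝ)` as a space
of matrices. -/
structure IsRightInvariantMetric (m : MetricSpace H3R) : Prop where
  compatible : m.toUniformSpace.toTopologicalSpace =
    TopologicalSpace.induced H3R.mat inferInstance
  dist_mul_right : ∀ g h k : H3R, m.dist (g * k) (h * k) = m.dist g h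

section Recurrence

variable {X : Type*} [MeasurableSpace X] [MulAction H3Z X]

/-- Recurrence of an action of `H₃(ℤ)` along a line `θ`. -/
def IsRecurrentAlong (m : MetricSpace H3R) (μ : Measure X) (θ : ℙ ℝ h3) : Prop :=
  ∀ ε : ℝ, 0 < ε → ∀ A : Set X, MeasurableSet A → 0 < μ A →
    ∃ γ : H3Z, γ ≠ 1 ∧ ∃ g ∈ expLine θ, m.dist (γ : H3R) g < ε ∧ 0 < μ (A ∩ γ • A)

/-- Even recurrence: recurrence along every line in the adjoint orbit of `θ`. -/
def IsEvenlyRecurrentAlong (m : MetricSpace H3R) (μ : Measure X) (θ : ℙ ℝ h3) : Prop :=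
  ∀ θ' ∈ MulAction.orbit H3R θ, IsRecurrentAlong m μ θ'

/-- The set of recurrent lines. -/
def recurrentLines (m : MetricSpace H3R) (μ : Measure X) : Set (ℙ ℝ h3) :=
  {θ | IsRecurrentAlong m μ θ}

/-- The set of evenly recurrent lines. -/
def evenlyRecurrentLines (m : MetricSpace H3R) (μ : Measure X) : Set (ℙ ℝ h3) :=
  {θ | IsEvenlyRecurrentAlong m μ θ}

end Recurrence

end Heisenberg

/-- A (left) Følner sequence of finite subsets of a discrete group, the size of a set being its
cardinality. -/
def IsFolnerSequence {Γ : Type*} [Group Γ] (F : ℕ → Finset Γ) : Prop :=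
  letI : MeasurableSpace Γ := ⊤
  IsFoelner Γ (Measure.count : Measure Γ) atTop fun n => (F n : Set Γ)

/-- Rank one: there are Rokhlin towers with base `B n` and levels indexed by `F n`, where `F` is a
Følner sequence, such that every measurable set of finite measure is approximated by unions of
levels of the `n`-th tower, as `n → ∞`. -/
def IsRankOne (Γ : Type*) [Group Γ] {X : Type*} [MeasurableSpace X] [MulAction Γ X]
    (μ : Measure X) : Prop :=
  ∃ (B : ℕ → Set X) (F : ℕ → Finset Γ),
    IsFolnerSequence F ∧
    (∀ n, MeasurableSet (B n) ∧ 0 < μ (B n) ∧ μ (B n) < ∞) ∧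
    (∀ n, (F n : Set Γ).PairwiseDisjoint fun f => f • B n) ∧
    ∀ A : Set X, MeasurableSet A → μ A < ∞ →
      ∃ S : ℕ → Finset Γ, (∀ n, S n ⊆ F n) ∧
        Tendsto (fun n => μ (A ∆ ⋃ f ∈ S n, f • B n)) atTop (𝓝 0)

end

open Heisenberg

/-
`H₃(ℤ)` acts on `H₃(ℤ_[2])` by left translation, which makes the action free. Attach to a sequence
of binary digits `x` the point `∑ x i * scale i * d i` of the abelian subgroup `y = 0`, where the
directions `d i = (x, z)` run through `(0, 1)` and all `(1, l)`, each infinitely often, and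
`scale i` is a rapidly growing power of `2`. The points form a Cantor set whose partial translations
under `H₃(ℤ)` preserve the Haar measure of the digits, so this measure extends to an invariant
measure on all translates. The points whose first `n` digits vanish are the base of the `n`-th
Rokhlin tower.

Changing the `i`-th digit is the translation by `scale i * d i`, which lies in `exp θ_l` or
`exp θ_∞`; conjugating it in `H₃(ℤ)` only shifts `l`, whence recurrence along all these lines.
Conversely, a nontrivial element that returns to the base of the `n`-th tower is a signed sum of
steps `scale i * d i` with `i ≥ n`, in which the last step outweighs the others. If `t` is not an
integer and `n` is large, such an element is far from `exp θ_t`; and since it has `y = 0`, it is far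
from `exp θ` for every line `θ` outside the plane `y = 0`.
-/

noncomputable section

namespace Heisenberg

/-! ### Heisenberg groups in coordinates -/

/-- The Heisenberg group over a ring `R` in the coordinates of the upper unitriangular matrix with
entries `x`, `y` next to the diagonal and `z` in the corner. -/
@[ext]
structure Heis (R : Type*) where
  x : R
  y : R
  z : R

namespace Heis

variable {R S : Type*}

/-- Heisenberg coordinates as a triple, used to transport the topology of `R × R × R`. -/
def equivProd : Heis R ≃ R × R × R where
  toFun g := (g.x, g.y, g.z)
  invFun p := ⟨p.1, p.2.1, p.2.2⟩

section Group

variable [CommRing R] [CommRing S]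

instance : One (Heis R) := ⟨⟨0, 0, 0⟩⟩
instance : Mul (Heis R) := ⟨fun g h => ⟨g.x + h.x, g.y + h.y, g.z + h.z + g.x * h.y⟩⟩
instance : Inv (Heis R) := ⟨fun g => ⟨-g.x, -g.y, g.x * g.y - g.z⟩⟩

@[simp] theorem one_x : (1 : Heis R).x = 0 := rfl
@[simp] theorem one_y : (1 : Heis R).y = 0 := rfl
@[simp] theorem one_z : (1 : Heis R).z = 0 := rfl
@[simp] theorem mul_x (g h : Heis R) : (g * h).x = g.x + h.x := rfl
@[simp] theorem mul_y (g h : Heis R) : (g * h).y = g.y + h.y := rfl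
@[simp] theorem mul_z (g h : Heis R) : (g * h).z = g.z + h.z + g.x * h.y := rfl
@[simp] theorem inv_x (g : Heis R) : g⁻¹.x = -g.x := rfl
@[simp] theorem inv_y (g : Heis R) : g⁻¹.y = -g.y := rfl
@[simp] theorem inv_z (g : Heis R) : g⁻¹.z = g.x * g.y - g.z := rfl

instance : Group (Heis R) :=
  Group.ofLeftAxioms (fun _ _ _ => by ext <;> simp <;> ring) (fun _ => by ext <;> simp)
    (fun _ => by ext <;> simp)

/-- The homomorphism of Heisenberg groups induced by a ring homomorphism. -/
@[simps]
def map (f : R →+* S) : Heis R →* Heis S where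
  toFun g := ⟨f g.x, f g.y, f g.z⟩
  map_one' := by ext <;> simp
  map_mul' g h := by ext <;> simp

theorem map_injective {f : R →+* S} (hf : Function.Injective f) :
    Function.Injective (map f) := fun g h hgh => by
  ext
  · exact hf congr(($hgh).x)
  · exact hf congr(($hgh).y)
  · exact hf congr(($hgh).z)

end Group

section Topology

variable [TopologicalSpace R]

instance : TopologicalSpace (Heis R) := .induced equivProd inferInstance

/-- The Heisenberg group over a topological ring is `R × R × R` as a topological space. -/
def homeomorphProd : Heis R ≃ₜ R × R × R := equivProd.toHomeomorphOfIsInducing ⟨rfl⟩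

theorem continuous_x : Continuous (x : Heis R → R) := homeomorphProd.continuous.fst
theorem continuous_y : Continuous (y : Heis R → R) := homeomorphProd.continuous.snd.fst
theorem continuous_z : Continuous (z : Heis R → R) := homeomorphProd.continuous.snd.snd

theorem continuous_mk {Y : Type*} [TopologicalSpace Y] {a b c : Y → R} (ha : Continuous a)
    (hb : Continuous b) (hc : Continuous c) : Continuous fun p => (⟨a p, b p, c p⟩ : Heis R) :=
  homeomorphProd.symm.continuous.comp (ha.prodMk (hb.prodMk hc))

instance [CommRing R] [IsTopologicalRing R] : ContinuousMul (Heis R) where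
  continuous_mul := by
    have hx := continuous_x (R := R)
    have hy := continuous_y (R := R)
    have hz := continuous_z (R := R)
    exact continuous_mk (by fun_prop) (by fun_prop) (by fun_prop)

instance [PolishSpace R] : PolishSpace (Heis R) :=
  homeomorphProd.isClosedEmbedding.polishSpace

instance : MeasurableSpace (Heis R) := borel _
instance : BorelSpace (Heis R) := ⟨rfl⟩

end Topology

end Heis

theorem H3R.mat_injective : Function.Injective H3R.mat :=
  Subtype.val_injective.comp Subtype.val_injective

theorem H3R.mat_eq_upper (g : H3R) :
    H3R.mat g = upper 1 (H3R.mat g 0 1) (H3R.mat g 1 2) (H3R.mat g 0 2) := by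
  obtain ⟨x, y, z, h⟩ := g.2
  rw [show H3R.mat g = upper 1 x y z from h]
  simp [upper]

/-- The matrix group `H₃(ℝ)` in coordinates. -/
def H3R.coords : H3R ≃* Heis ℝ where
  toFun g := ⟨H3R.mat g 0 1, H3R.mat g 1 2, H3R.mat g 0 2⟩
  invFun k := ⟨⟨upper 1 k.x k.y k.z, by simp [upper, Matrix.det_fin_three]⟩, k.x, k.y, k.z, rfl⟩
  left_inv g := H3R.mat_injective (H3R.mat_eq_upper g).symm
  right_inv k := by ext <;> simp [H3R.mat, upper]
  map_mul' g h := by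
    rw [H3R.mat_mul, H3R.mat_eq_upper g, H3R.mat_eq_upper h, upper_mul]
    ext <;> simp [upper] <;> ring

theorem H3R.mat_coords_symm (k : Heis ℝ) : H3R.mat (H3R.coords.symm k) = upper 1 k.x k.y k.z :=
  rfl

theorem H3R.coords_apply (g : H3R) :
    H3R.coords g = ⟨H3R.mat g 0 1, H3R.mat g 1 2, H3R.mat g 0 2⟩ := rfl

theorem H3R.mem_H3Z_iff {g : H3R} :
    g ∈ H3Z ↔ ∃ k : Heis ℤ, k.map (Int.castRingHom ℝ) = H3R.coords g := by
  refine ⟨fun ⟨a, b, c, h⟩ => ⟨⟨a, b, c⟩, ?_⟩, fun ⟨k, hk⟩ => ⟨k.x, k.y, k.z, ?_⟩⟩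
  · ext <;> simp [H3R.coords_apply, h, upper]
  · rw [← H3R.coords.symm_apply_apply g, ← hk, H3R.mat_coords_symm]
    simp

theorem intCast_map_injective : Function.Injective (Heis.map (Int.castRingHom ℝ)) :=
  Heis.map_injective (RingHom.injective_int _)

/-- The lattice `H₃(ℤ)` in coordinates. -/
def H3Z.coords : H3Z ≃* Heis ℤ :=
  .symm <| .ofBijective
    ((H3R.coords.symm.toMonoidHom.comp (Heis.map (Int.castRingHom ℝ))).codRestrict H3Z fun k =>
      H3R.mem_H3Z_iff.2 ⟨k, (H3R.coords.apply_symm_apply _).symm⟩)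
    ⟨fun _ _ h => intCast_map_injective (H3R.coords.symm.injective congr(($h).1)), fun γ => by
      obtain ⟨k, hk⟩ := H3R.mem_H3Z_iff.1 γ.2
      exact ⟨k, Subtype.ext <| H3R.coords.symm_apply_eq.2 hk⟩⟩

theorem H3R.coords_coe (γ : H3Z) :
    H3R.coords γ = (H3Z.coords γ).map (Int.castRingHom ℝ) := by
  obtain ⟨k, rfl⟩ := H3Z.coords.symm.surjective γ
  rw [MulEquiv.apply_symm_apply]
  exact H3R.coords.apply_symm_apply _

instance : Countable H3Z :=
  (Heis.equivProd.injective.comp H3Z.coords.injective).countable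

/-- The homomorphism `H₃(ℤ) → H₃(R)`. -/
def embed (R : Type*) [CommRing R] : H3Z →* Heis R :=
  (Heis.map (Int.castRingHom R)).comp H3Z.coords.toMonoidHom

section Embed

variable {R : Type*} [CommRing R] (γ : H3Z)

@[simp] theorem embed_x : (embed R γ).x = (H3Z.coords γ).x := rfl
@[simp] theorem embed_y : (embed R γ).y = (H3Z.coords γ).y := rfl
@[simp] theorem embed_z : (embed R γ).z = (H3Z.coords γ).z := rfl

theorem embed_injective [CharZero R] : Function.Injective (embed R) :=
  (Heis.map_injective (RingHom.injective_int _)).comp H3Z.coords.injective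

end Embed

theorem exp_upper_zero (x y z : ℝ) :
    NormedSpace.exp (upper 0 x y z) = upper 1 x y (z + x * y / 2) := by
  have h_sq : upper 0 x y z ^ 2 = upper 0 0 0 (x * y) := by
    rw [pow_two, upper_mul]
    simp
  have h_cube : upper 0 x y z ^ 3 = 0 := by
    rw [pow_succ, h_sq, upper_mul]
    ext i j
    fin_cases i <;> fin_cases j <;> simp [upper]
  rw [NormedSpace.exp_eq_tsum ℝ]
  dsimp only
  rw [tsum_eq_sum (s := .range 3)]
  · simp only [Finset.sum_range_succ, Finset.sum_range_zero, h_sq]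
    ext i j
    fin_cases i <;> fin_cases j <;> (simp [upper]; try ring)
  · intro n hn
    rw [Finset.mem_range, not_lt] at hn
    rw [pow_eq_zero_of_le hn h_cube, smul_zero]

/-- The element of the Lie algebra with given entries. -/
def h3.of (x y z : ℝ) : h3 := ⟨upper 0 x y z, x, y, z, rfl⟩

theorem h3.of_surjective (v : h3) : ∃ x y z, v = h3.of x y z := by
  obtain ⟨x, y, z, h⟩ := v.2
  exact ⟨x, y, z, Subtype.ext h⟩

theorem h3.smul_of (s x y z : ℝ) : s • h3.of x y z = h3.of (s * x) (s * y) (s * z) := by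
  apply Subtype.ext
  ext i j
  fin_cases i <;> fin_cases j <;> simp [upper, h3.of]

theorem h3.of_one_ne_zero (a c : ℝ) : h3.of a 1 c ≠ 0 := fun h => by
  simpa [upper, h3.of] using congr((($h : h3) : Matrix (Fin 3) (Fin 3) ℝ) 1 2)

theorem adjoint_smul_of (g : H3R) (a b c : ℝ) :
    g • h3.of a b c = h3.of a b (c + (H3R.coords g).x * b - (H3R.coords g).y * a) := by
  obtain ⟨k, rfl⟩ := H3R.coords.symm.surjective g
  apply Subtype.ext
  change H3R.mat (H3R.coords.symm k) * upper 0 a b c * H3R.mat (H3R.coords.symm k)⁻¹ = _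
  rw [H3R.mat_inv, H3R.mat_coords_symm, adjugate_upper, upper_mul, upper_mul,
    MulEquiv.apply_symm_apply]
  ext i j
  fin_cases i <;> fin_cases j <;> simp [upper, h3.of]
  ring

theorem mem_expLine_mk {a b c : ℝ} (h : h3.of a b c ≠ 0) (g : H3R) :
    g ∈ expLine (.mk ℝ (h3.of a b c) h) ↔
      ∃ s : ℝ, H3R.coords g = ⟨s * a, s * b, s * c + s * a * (s * b) / 2⟩ := by
  have h_exp (s : ℝ) :
      H3R.mat g = NormedSpace.exp ((s • h3.of a b c : h3) : Matrix (Fin 3) (Fin 3) ℝ) ↔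
        H3R.coords g = ⟨s * a, s * b, s * c + s * a * (s * b) / 2⟩ := by
    rw [h3.smul_of, h3.of, exp_upper_zero, ← H3R.coords.eq_symm_apply, ← H3R.mat_injective.eq_iff,
      H3R.mat_coords_symm]
  simp only [expLine, Projectivization.submodule_mk, Submodule.mem_span_singleton,
    Set.mem_ofPred_eq, exists_exists_eq_and, h_exp]

theorem mem_expLine_thetaLine {t : ℝ} {g : H3R} :
    g ∈ expLine (thetaLine t) ↔ ∃ s : ℝ, H3R.coords g = ⟨s, 0, s * t⟩ :=
  (mem_expLine_mk (a := 1) (b := 0) _ g).trans (by simp)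

theorem mem_expLine_thetaInf {g : H3R} :
    g ∈ expLine thetaInf ↔ ∃ s : ℝ, H3R.coords g = ⟨0, 0, s⟩ :=
  (mem_expLine_mk (a := 0) (b := 0) (c := 1) _ g).trans (by simp)

theorem line_cases (θ : ℙ ℝ h3) :
    (∃ a c, θ = .mk ℝ (h3.of a 1 c) (h3.of_one_ne_zero a c)) ∨
      (∃ t, θ = thetaLine t) ∨ θ = thetaInf := by
  induction θ using Projectivization.ind with
  | h v hv =>
    obtain ⟨a, b, c, rfl⟩ := h3.of_surjective v
    obtain rfl | hb := eq_or_ne b 0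
    · obtain rfl | ha := eq_or_ne a 0
      · refine .inr (.inr ((Projectivization.mk_eq_mk_iff' ℝ _ (h3.of 0 0 1) ..).2 ⟨c, ?_⟩))
        simp [h3.smul_of]
      · refine .inr (.inl ⟨c / a,
          (Projectivization.mk_eq_mk_iff' ℝ _ (h3.of 1 0 (c / a)) ..).2 ⟨a, ?_⟩⟩)
        simp [h3.smul_of, mul_div_cancel₀ _ ha]
    · refine .inl ⟨a / b, c / b, (Projectivization.mk_eq_mk_iff' ..).2 ⟨b, ?_⟩⟩
      simp [h3.smul_of, mul_div_cancel₀ _ hb]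

theorem smul_thetaInf (g : H3R) : g • thetaInf = thetaInf :=
  (Projectivization.mk_eq_mk_iff' ℝ (g • h3.of 0 0 1) (h3.of 0 0 1) ..).2
    ⟨1, by rw [one_smul, adjoint_smul_of]; simp⟩

theorem thetaLine_mem_orbit (s t : ℝ) : thetaLine t ∈ MulAction.orbit H3R (thetaLine s) :=
  ⟨H3R.coords.symm ⟨0, s - t, 0⟩,
    (Projectivization.mk_eq_mk_iff' ℝ (H3R.coords.symm ⟨0, s - t, 0⟩ • h3.of 1 0 s)
      (h3.of 1 0 t) ..).2
      ⟨1, by rw [one_smul, adjoint_smul_of]; simp⟩⟩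

theorem IsRightInvariantMetric.exists_forall_dist_lt {m : MetricSpace H3R}
    (hm : IsRightInvariantMetric m) {U : Set (Heis ℝ)} (hU : U ∈ 𝓝 1) :
    ∃ ε > 0, ∀ g h : H3R, m.dist g h < ε → H3R.coords (g * h⁻¹) ∈ U := by
  have h_nhds : H3R.coords ⁻¹' U ∈ @nhds H3R m.toUniformSpace.toTopologicalSpace 1 := by
    have h_entry (i j : Fin 3) : Continuous fun A : Matrix (Fin 3) (Fin 3) ℝ => A i j :=
      continuous_id.matrix_elem i j
    have h_entries := Heis.continuous_mk (h_entry 0 1) (h_entry 1 2) (h_entry 0 2)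
    rw [hm.compatible, nhds_induced]
    refine preimage_mem_comap (h_entries.continuousAt.preimage_mem_nhds ?_)
    rwa [← H3R.coords_apply, map_one]
  let _ := m
  obtain ⟨ε, hε, h_ball⟩ := Metric.mem_nhds_iff.1 h_nhds
  refine ⟨ε, hε, fun g h h_dist => h_ball ?_⟩
  have h_inv := hm.dist_mul_right g h h⁻¹
  rw [mul_inv_cancel] at h_inv
  exact h_inv.trans_lt h_dist

/-! ### Scales and sums of steps -/

/-- Half of the `i`-th scale; the boxes of the Rokhlin towers have this radius. -/
def halfScale (i : ℕ) : ℤ := 2 ^ (i * (i + 2))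

/-- The `i`-th scale, the size of the translation that changes the `i`-th digit. The exponent is
quadratic in `i` so that a scale dominates all earlier steps. -/
def scale (i : ℕ) : ℤ := 2 ^ (i * (i + 2) + 1)

theorem scale_eq (i : ℕ) : scale i = 2 * halfScale i := by
  rw [scale, halfScale, pow_succ, mul_comm]

theorem scale_succ (i : ℕ) : scale (i + 1) = 2 ^ (2 * i + 3) * scale i := by
  rw [scale, scale, ← pow_add]
  congr 1
  ring

theorem scale_pos (i : ℕ) : 0 < scale i := by unfold scale; positivity

theorem lt_halfScale (i : ℕ) : (i : ℤ) < halfScale i := by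
  have h : i < 2 ^ (i * (i + 2)) :=
    Nat.lt_two_pow_self.trans_le (Nat.pow_le_pow_right two_pos (by nlinarith))
  unfold halfScale
  exact_mod_cast h

theorem scale_dvd_scale {i j : ℕ} (h : i ≤ j) : scale i ∣ scale j :=
  pow_dvd_pow _ (by nlinarith)

theorem eight_mul_scale_dvd (i : ℕ) : 8 * scale i ∣ scale (i + 1) := by
  rw [scale_succ, pow_add]
  exact ⟨2 ^ (2 * i), by ring⟩

/-- The integer `∑ i < n, scale i * a i`. -/
def partialSum (a : ℕ → ℤ) (n : ℕ) : ℤ := ∑ i ∈ .range n, scale i * a i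

theorem partialSum_succ (a : ℕ → ℤ) (n : ℕ) :
    partialSum a (n + 1) = partialSum a n + scale n * a n :=
  Finset.sum_range_succ _ _

theorem partialSum_eq_zero {a : ℕ → ℤ} {n : ℕ} (h : ∀ i < n, a i = 0) : partialSum a n = 0 :=
  Finset.sum_eq_zero fun i hi => by rw [h i (Finset.mem_range.1 hi), mul_zero]

theorem scale_dvd_partialSum {a : ℕ → ℤ} {N : ℕ} (h : ∀ i < N, a i = 0) (n : ℕ) :
    scale N ∣ partialSum a n :=
  Finset.dvd_sum fun i _ => by
    obtain hi | hi := lt_or_ge i N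
    · simp [h i hi]
    · exact (scale_dvd_scale hi).mul_right _

theorem mul_abs_partialSum_le {a : ℕ → ℤ} (ha : ∀ i : ℕ, |a i| ≤ i + 1) (n : ℕ) :
    (n + 1) * |partialSum a n| ≤ halfScale n := by
  suffices 2 * (n + 1) * |partialSum a n| ≤ scale n by linarith [scale_eq n]
  induction n with
  | zero => simpa [partialSum] using (scale_pos 0).le
  | succ n ih =>
    have h_step : |partialSum a (n + 1)| ≤ |partialSum a n| + (n + 1) * scale n := by
      rw [partialSum_succ]
      refine (abs_add_le _ _).trans (add_le_add_right ?_ _)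
      rw [abs_mul, abs_of_pos (scale_pos n), mul_comm]
      exact mul_le_mul_of_nonneg_right (ha n) (scale_pos n).le
    have h_prev : 2 * |partialSum a n| ≤ scale n := by nlinarith [abs_nonneg (partialSum a n)]
    have h_pow : ((n : ℤ) + 2) ^ 2 ≤ 2 ^ (2 * n + 2) := by
      have h : (n + 2 : ℤ) ≤ 2 ^ (n + 1) := mod_cast Nat.lt_two_pow_self (n := n + 1)
      calc ((n : ℤ) + 2) ^ 2 ≤ (2 ^ (n + 1)) ^ 2 := by gcongr
        _ = 2 ^ (2 * n + 2) := by ring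
    calc 2 * (((n + 1 : ℕ) : ℤ) + 1) * |partialSum a (n + 1)|
        ≤ 2 * (((n + 1 : ℕ) : ℤ) + 1) * (|partialSum a n| + (n + 1) * scale n) := by gcongr
      _ ≤ 2 * (n + 2) ^ 2 * scale n := by push_cast; nlinarith [scale_pos n]
      _ ≤ 2 * 2 ^ (2 * n + 2) * scale n := by gcongr; exact (scale_pos n).le
      _ = scale (n + 1) := by rw [scale_succ]; ring

theorem norm_scale_mul_le (a : ℤ) (i : ℕ) : ‖((scale i * a : ℤ) : ℤ_[2])‖ ≤ (1 / 2) ^ i := by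
  have h_norm : ‖((scale i : ℤ) : ℤ_[2])‖ ≤ (1 / 2) ^ i := by
    have h_two : ‖(2 : ℤ_[2])‖ = 1 / 2 := by simpa using PadicInt.norm_p (p := 2)
    rw [scale, Int.cast_pow, norm_pow, Int.cast_ofNat, h_two]
    exact pow_le_pow_of_le_one (by norm_num) (by norm_num) (by nlinarith)
  rw [Int.cast_mul, norm_mul]
  exact (mul_le_of_le_one_right (norm_nonneg _) (PadicInt.norm_le_one _)).trans h_norm

theorem summable_scale_mul (a : ℕ → ℤ) : Summable fun i => ((scale i * a i : ℤ) : ℤ_[2]) :=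
  .of_norm_bounded summable_geometric_two fun i => norm_scale_mul_le (a i) i

/-- The `2`-adic integer `∑ scale i * a i`. -/
def padicSum : (ℕ → ℤ) →+ ℤ_[2] where
  toFun a := ∑' i, ((scale i * a i : ℤ) : ℤ_[2])
  map_zero' := by simp
  map_add' a b := by
    rw [← (summable_scale_mul a).tsum_add (summable_scale_mul b)]
    simp [mul_add]

theorem padicSum_apply (a : ℕ → ℤ) : padicSum a = ∑' i, ((scale i * a i : ℤ) : ℤ_[2]) := rfl

theorem padicSum_eq_partialSum {a : ℕ → ℤ} {n : ℕ} (h : ∀ i, n ≤ i → a i = 0) :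
    padicSum a = partialSum a n := by
  rw [padicSum_apply, tsum_eq_sum (s := .range n), partialSum, Int.cast_sum]
  intro i hi
  rw [h i (by simpa using hi), mul_zero, Int.cast_zero]

theorem continuous_padicSum : Continuous padicSum :=
  continuous_tsum
    (fun i => (continuous_of_discreteTopology (f := fun k : ℤ => ((scale i * k : ℤ) : ℤ_[2]))).comp
      (continuous_apply i))
    summable_geometric_two fun i a => norm_scale_mul_le (a i) i

theorem scale_dvd_intCast_iff {n : ℕ} {k : ℤ} : ((scale n : ℤ) : ℤ_[2]) ∣ k ↔ scale n ∣ k := by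
  simpa [scale] using PadicInt.pow_p_dvd_int_iff (p := 2) (n * (n + 2) + 1) k

theorem scale_dvd_padicSum_sub_partialSum (a : ℕ → ℤ) (n : ℕ) :
    ((scale n : ℤ) : ℤ_[2]) ∣ padicSum a - partialSum a n := by
  have h_tail : padicSum a - partialSum a n = ∑' i, ((scale (i + n) * a (i + n) : ℤ) : ℤ_[2]) := by
    rw [padicSum_apply, ← (summable_scale_mul a).sum_add_tsum_nat_add n, partialSum, Int.cast_sum,
      add_sub_cancel_left]
  have h_scale : ((scale n : ℤ) : ℤ_[2]) = 2 ^ (n * (n + 2) + 1) := by simp [scale]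
  rw [h_tail, h_scale, ← Ideal.mem_span_singleton]
  refine (PadicInt.norm_le_pow_iff_mem_span_pow (p := 2) _ _).1
    (IsUltrametricDist.norm_tsum_le_of_forall_le fun i => ?_)
  refine (PadicInt.norm_int_le_pow_iff_dvd (p := 2)).2 ?_
  have h_dvd : scale n ∣ scale (i + n) * a (i + n) := (scale_dvd_scale (by omega)).mul_right _
  exact_mod_cast h_dvd

theorem scale_dvd_of_padicSum_eq {a : ℕ → ℤ} {k : ℤ} (h : padicSum a = k) (n : ℕ) :
    scale n ∣ k - partialSum a n := by
  rw [← scale_dvd_intCast_iff, Int.cast_sub, ← h]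
  exact scale_dvd_padicSum_sub_partialSum a n

theorem eventually_eq_partialSum {a : ℕ → ℤ} (ha : ∀ i : ℕ, |a i| ≤ i + 1) {k : ℤ}
    (h : padicSum a = k) : ∀ᶠ n in atTop, k = partialSum a n := by
  filter_upwards [eventually_ge_atTop k.natAbs] with n hn
  have h_k : |k| ≤ n := by rw [Int.abs_eq_natAbs]; exact_mod_cast hn
  have h_small : |k - partialSum a n| < scale n := by
    have h_sum := mul_abs_partialSum_le ha n
    nlinarith [h_k, abs_sub k (partialSum a n), abs_nonneg (partialSum a n), lt_halfScale n,
      scale_eq n]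
  exact sub_eq_zero.1 (Int.eq_zero_of_abs_lt_dvd (scale_dvd_of_padicSum_eq h n) h_small)

/-- The direction `(x, z)` in which the `i`-th digit moves a point: `(0, 1)` or `(1, l)`, each of
them for infinitely many `i`. -/
def direction (i : ℕ) : ℤ × ℤ :=
  if Even i.unpair.2 then (0, 1) else (1, (i.unpair.1.unpair.1 : ℤ) - i.unpair.1.unpair.2)

theorem direction_cases (i : ℕ) : direction i = (0, 1) ∨ ∃ l : ℤ, direction i = (1, l) := by
  unfold direction
  split_ifs
  · exact .inl rfl
  · exact .inr ⟨_, rfl⟩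

theorem exists_ge_direction_eq_zero_one (N : ℕ) : ∃ m ≥ N, direction m = (0, 1) := by
  refine ⟨Nat.pair 0 (2 * N), ?_, ?_⟩
  · have := Nat.right_le_pair 0 (2 * N)
    omega
  · simp [direction]

theorem exists_ge_direction_eq_one (l : ℤ) (N : ℕ) : ∃ m ≥ N, direction m = (1, l) := by
  refine ⟨Nat.pair (Nat.pair l.toNat (-l).toNat) (2 * N + 1), ?_, ?_⟩
  · have := Nat.right_le_pair (Nat.pair l.toNat (-l).toNat) (2 * N + 1)
    omega
  · have : ¬ Even (2 * N + 1) := by simp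
    simp [direction]

/-- The first component of `direction`. -/
def dirX (i : ℕ) : ℤ := (direction i).1

/-- The second component of `direction`. -/
def dirZ (i : ℕ) : ℤ := (direction i).2

theorem abs_dirX_le (i : ℕ) : |dirX i| ≤ i + 1 := by
  have h : |dirX i| ≤ 1 := by obtain h | ⟨l, h⟩ := direction_cases i <;> simp [dirX, h]
  linarith [Int.natCast_nonneg i]

theorem abs_dirZ_le (i : ℕ) : |dirZ i| ≤ i + 1 := by
  have h₁ := Nat.unpair_left_le i
  have h₂ := Nat.unpair_left_le i.unpair.1
  have h₃ := Nat.unpair_right_le i.unpair.1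
  unfold dirZ direction
  split_ifs <;> simp only [abs_le] <;> omega

theorem abs_mul_le_of_abs_le_one {η d : ℕ → ℤ} (hη : ∀ i, |η i| ≤ 1)
    (hd : ∀ i : ℕ, |d i| ≤ i + 1) (i : ℕ) : |(η * d) i| ≤ i + 1 := by
  rw [Pi.mul_apply, abs_mul]
  exact (mul_le_of_le_one_left (abs_nonneg _) (hη i)).trans (hd i)

/-- The element of `H₃(ℤ_[2])` obtained by moving by `η i * scale i` in the `i`-th direction, for
all `i`. -/
def signedSum (η : ℕ → ℤ) : Heis ℤ_[2] := ⟨padicSum (η * dirX), 0, padicSum (η * dirZ)⟩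

/-- The element of `H₃(ℤ)` obtained by moving by `η i * scale i` in the `i`-th direction, for all
`i < n`. -/
def signedStep (n : ℕ) (η : ℕ → ℤ) : H3Z :=
  H3Z.coords.symm ⟨partialSum (η * dirX) n, 0, partialSum (η * dirZ) n⟩

theorem coords_signedStep (n : ℕ) (η : ℕ → ℤ) :
    H3Z.coords (signedStep n η) = ⟨partialSum (η * dirX) n, 0, partialSum (η * dirZ) n⟩ :=
  H3Z.coords.apply_symm_apply _

theorem signedSum_sub (η θ : ℕ → ℤ) : signedSum (η - θ) = signedSum η * (signedSum θ)⁻¹ := by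
  ext <;> simp [signedSum, sub_mul] <;> ring

theorem continuous_signedSum : Continuous signedSum :=
  have h_part (d : ℕ → ℤ) : Continuous fun η : ℕ → ℤ => padicSum (η * d) :=
    continuous_padicSum.comp <| continuous_pi fun i =>
      continuous_of_discreteTopology (f := fun k : ℤ => k * d i) |>.comp (continuous_apply i)
  Heis.continuous_mk (h_part dirX) continuous_const (h_part dirZ)

theorem signedSum_eq_embed {η : ℕ → ℤ} {n : ℕ} (h : ∀ i, n ≤ i → η i = 0) :
    signedSum η = embed ℤ_[2] (signedStep n η) := by
  have h_sum (d : ℕ → ℤ) : padicSum (η * d) = partialSum (η * d) n :=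
    padicSum_eq_partialSum fun i hi => by simp [h i hi]
  ext <;> simp [signedSum, coords_signedStep, h_sum]

theorem eq_zero_of_signedSum_eq_one {η : ℕ → ℤ} (hη : ∀ i, |η i| ≤ 2) (h : signedSum η = 1) :
    η = 0 := by
  have h_lead (d : ℕ → ℤ) (hd : padicSum (η * d) = 0) (i : ℕ) (h_lt : ∀ j < i, η j = 0) :
      scale (i + 1) ∣ scale i * (η i * d i) := by
    have h_dvd := scale_dvd_of_padicSum_eq (hd.trans Int.cast_zero.symm) (i + 1)
    rwa [partialSum_succ, partialSum_eq_zero fun j hj => by simp [h_lt j hj], zero_add, zero_sub,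
      dvd_neg] at h_dvd
  ext i
  induction i using Nat.strong_induction_on with
  | _ i ih =>
    have h_dvd : scale (i + 1) ∣ scale i * η i := by
      obtain hi | ⟨l, hi⟩ := direction_cases i
      · simpa [dirZ, hi] using h_lead dirZ congr(($h).z) i ih
      · simpa [dirX, hi] using h_lead dirX congr(($h).x) i ih
    have h_eight : 8 ∣ η i := by
      refine (mul_dvd_mul_iff_left (scale_pos i).ne').1 ?_
      rw [mul_comm (scale i) 8]
      exact (eight_mul_scale_dvd i).trans h_dvd
    exact Int.eq_zero_of_abs_lt_dvd h_eight (by have := hη i; omega)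

theorem eventually_eq_signedStep {η : ℕ → ℤ} (hη : ∀ i, |η i| ≤ 1) {γ : H3Z}
    (h : embed ℤ_[2] γ = signedSum η) : ∀ᶠ n in atTop, γ = signedStep n η := by
  have h_y : (H3Z.coords γ).y = 0 := by
    have : ((H3Z.coords γ).y : ℤ_[2]) = 0 := congr(($h).y)
    exact_mod_cast this
  filter_upwards
    [eventually_eq_partialSum (abs_mul_le_of_abs_le_one hη abs_dirX_le) congr(($h).x).symm,
    eventually_eq_partialSum (abs_mul_le_of_abs_le_one hη abs_dirZ_le) congr(($h).z).symm]
    with n hx hz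
  apply H3Z.coords.injective
  rw [coords_signedStep]
  ext
  exacts [hx, h_y, hz]

theorem exists_leading_index {η : ℕ → ℤ} {n : ℕ} (h : signedStep n η ≠ 1) :
    ∃ i, η i ≠ 0 ∧ signedStep n η = signedStep (i + 1) η := by
  induction n with
  | zero =>
    refine absurd (H3Z.coords.injective ?_) h
    rw [coords_signedStep, map_one]
    rfl
  | succ n ih =>
    obtain hn | hn := eq_or_ne (η n) 0
    · have h_eq : signedStep (n + 1) η = signedStep n η := by
        simp [signedStep, partialSum_succ, hn]
      rw [h_eq] at h ⊢
      exact ih h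
    · exact ⟨n, hn, rfl⟩

/-! ### Invariant extensions of measures and approximation by towers -/

section InvariantExtension

variable {G X Y : Type*} [Group G] [MulAction G X] [MeasurableSpace X] [MeasurableSpace Y]

/-- The smallest measure above all translates of a given measure. It extends a measure on a subset
`K` of `X` to an invariant measure on `X`, provided that the partial maps `K → K` induced by the
action preserve the given measure. -/
def translatesSup (G : Type*) {X : Type*} [Group G] [MulAction G X] [MeasurableSpace X]
    (κ : Measure X) : Measure X := ⨆ g : G, κ.map (g • ·)

theorem map_le_translatesSup (κ : Measure X) (g : G) : κ.map (g • ·) ≤ translatesSup G κ :=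
  le_iSup (fun g : G => κ.map (g • ·)) g

theorem translatesSup_apply {κ : Measure X} {K : Set X} (hK : MeasurableSet K)
    (h : ∀ g : G, (κ.map (g • ·)).restrict K ≤ κ) {A : Set X} (hA : A ⊆ K) :
    translatesSup G κ A = κ A := by
  apply le_antisymm
  · have h_le : translatesSup G κ ≤ κ + (⊤ : Measure X).restrict Kᶜ := by
      refine iSup_le fun g => ?_
      rw [← Measure.restrict_add_restrict_compl (μ := κ.map (g • ·)) hK]
      exact add_le_add (h g) (Measure.restrict_mono subset_rfl le_top)
    have h_null : (⊤ : Measure X).restrict Kᶜ A = 0 :=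
      measure_mono_null hA (by rw [Measure.restrict_apply hK, Set.inter_compl_self, measure_empty])
    calc translatesSup G κ A ≤ (κ + (⊤ : Measure X).restrict Kᶜ) A := h_le A
      _ = κ A := by rw [Measure.add_apply, h_null, add_zero]
  · simpa using map_le_translatesSup κ (1 : G) A

variable [MeasurableConstSMul G X]

theorem translatesSup_image {e : Y → X} (he : MeasurableEmbedding e) {ν : Measure Y}
    (h : ∀ g : G, ∃ T : Y → Y, MeasurePreserving T ν ν ∧ ∀ x y, g • e x = e y → y = T x)
    (s : Set Y) : translatesSup G (ν.map e) (e '' s) = ν s := by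
  rw [translatesSup_apply he.measurableSet_range _ (Set.image_subset_range e s), he.map_apply,
    Set.preimage_image_eq s he.injective]
  intro g
  obtain ⟨T, hT, h_eq⟩ := h g
  refine Measure.le_iff.2 fun A hA => ?_
  have hA' := hA.inter he.measurableSet_range
  rw [Measure.restrict_apply hA, Measure.map_apply (measurable_const_smul g) hA', he.map_apply,
    he.map_apply, ← hT.measure_preimage (he.measurable hA).nullMeasurableSet]
  refine measure_mono ?_
  rintro x ⟨hxA, y, hy⟩
  rw [Set.mem_preimage, Set.mem_preimage, ← h_eq x y hy.symm, hy]
  exact hxA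

theorem translatesSup_le_preimage (κ : Measure X) (g : G) {A : Set X} (hA : MeasurableSet A) :
    translatesSup G κ A ≤ translatesSup G κ ((g • ·) ⁻¹' A) := by
  suffices translatesSup G κ ≤ (translatesSup G κ).map (g • ·) by
    rw [← Measure.map_apply (measurable_const_smul g) hA]
    exact this A
  refine iSup_le fun h => ?_
  have h_map : κ.map (h • ·) = (κ.map ((g⁻¹ * h) • ·)).map (g • ·) := by
    rw [Measure.map_map (measurable_const_smul g) (measurable_const_smul _)]
    congr 1
    ext x
    rw [Function.comp_apply, ← mul_smul, mul_inv_cancel_left]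
  rw [h_map]
  exact Measure.map_mono (map_le_translatesSup κ _) (measurable_const_smul g)

instance (κ : Measure X) : SMulInvariantMeasure G X (translatesSup G κ) where
  measure_preimage_smul g A hA := by
    refine le_antisymm ?_ (translatesSup_le_preimage κ g hA)
    have h := translatesSup_le_preimage κ g⁻¹ (measurable_const_smul g hA)
    simpa only [← Set.preimage_comp, Function.comp_def, smul_inv_smul, Set.preimage_id'] using h

theorem translatesSup_compl_eq_zero [Countable G] {κ : Measure X} {K : Set X}
    (h : κ Kᶜ = 0) : translatesSup G κ (⋃ g : G, g • K)ᶜ = 0 := by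
  have h_le : translatesSup G κ ≤ Measure.sum fun g : G => κ.map (g • ·) :=
    iSup_le fun g => Measure.le_sum (fun g : G => κ.map (g • ·)) g
  refine Measure.absolutelyContinuous_of_le h_le (Measure.sum_apply_eq_zero.2 fun g => ?_)
  rw [(measurableEmbedding_const_smul g).map_apply]
  exact measure_mono_null (fun x hx hxK => hx (Set.mem_iUnion.2 ⟨g, Set.smul_mem_smul_set hxK⟩)) h

end InvariantExtension

section Translates

variable {G X : Type*} [Group G] [MulAction G X] [MeasurableSpace X]
  {μ : Measure X} {K A : Set X}

theorem exists_measure_inter_smul_pos [Countable G] (h : μ (⋃ g : G, g • K)ᶜ = 0) (hA : 0 < μ A) :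
    ∃ g : G, 0 < μ (A ∩ g • K) := by
  by_contra! h_null
  refine hA.ne' (measure_mono_null (fun x hx => ?_) (measure_union_null
    (measure_iUnion_null fun g : G => le_antisymm (h_null g) zero_le) h))
  rw [← Set.inter_iUnion]
  exact or_iff_not_imp_left.2 fun hx' hx'' => hx' ⟨hx, hx''⟩

variable [SMulInvariantMeasure G X μ]

theorem sigmaFinite_of_measure_compl_iUnion_smul_eq_zero [Countable G] (hK : μ K < ∞)
    (h : μ (⋃ g : G, g • K)ᶜ = 0) : SigmaFinite μ := by
  let pieces : Set (Set X) := insert (⋃ g : G, g • K)ᶜ (Set.range fun g : G => g • K)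
  have h_finite : ∀ s ∈ pieces, μ s < ∞ := by
    rintro s (rfl | ⟨g, rfl⟩)
    · rw [h]
      exact ENNReal.zero_lt_top
    · rwa [measure_smul]
  refine Measure.sigmaFinite_of_countable ((Set.countable_range _).insert _) h_finite ?_
  rw [Set.sUnion_insert, Set.sUnion_range, Set.compl_union_self]

theorem measure_univ_eq_top_of_pairwise_disjoint_smul [MeasurableConstSMul G X] {ι : Type*}
    [Infinite ι] {g : ι → G} (hK : MeasurableSet K) (hpos : μ K ≠ 0)
    (h : Pairwise (Function.onFun Disjoint fun i => g i • K)) : μ Set.univ = ∞ := by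
  refine measure_mono_top (Set.subset_univ (⋃ i, g i • K)) (top_unique ?_)
  calc ∞ = ∑' i, μ (g i • K) := by
          simp only [measure_smul, ENNReal.tsum_const_eq_top_of_ne_zero hpos]
    _ ≤ μ (⋃ i, g i • K) := tsum_meas_le_meas_iUnion_of_disjoint μ (fun i => hK.const_smul _) h

end Translates

theorem exists_finset_measure_diff_iUnion_le {ι X : Type*} [Countable ι] [MeasurableSpace X]
    {μ : Measure X} {A : Set X} {t : ι → Set X} (hA : MeasurableSet A) (hA' : μ A ≠ ∞)
    (ht : ∀ i, MeasurableSet (t i)) (h : μ (⋃ i, t i)ᶜ = 0) {ε : ℝ≥0∞} (hε : 0 < ε) :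
    ∃ s : Finset ι, μ (A \ ⋃ i ∈ s, t i) ≤ ε := by
  have h_anti : Antitone fun s : Finset ι => A \ ⋃ i ∈ s, t i := fun s s' hs =>
    Set.sdiff_subset_sdiff_right (Set.biUnion_subset_biUnion_left hs)
  have h_lim := tendsto_measure_iInter_atTop (μ := μ)
    (fun s => (hA.diff (s.measurableSet_biUnion fun i _ => ht i)).nullMeasurableSet) h_anti
    ⟨∅, ((measure_mono Set.sdiff_subset).trans_lt hA'.lt_top).ne⟩
  have h_null : μ (⋂ s : Finset ι, A \ ⋃ i ∈ s, t i) = 0 := by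
    refine measure_mono_null (t := (⋃ i, t i)ᶜ) (fun x hx hx' => ?_) h
    obtain ⟨i, hi⟩ := Set.mem_iUnion.1 hx'
    exact (Set.mem_iInter.1 hx {i}).2 (Set.mem_biUnion (Finset.mem_singleton_self i) hi)
  rw [h_null] at h_lim
  obtain ⟨s, hs⟩ := (h_lim.eventually_lt_const hε).exists
  exact ⟨s, hs.le⟩

theorem eventually_measure_inter_vadd_ne_zero {V : Type*} [AddGroup V] [TopologicalSpace V]
    [IsTopologicalAddGroup V] [T2Space V] [LocallyCompactSpace V] [MeasurableSpace V] [BorelSpace V]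
    {μ : Measure V} [μ.IsAddHaarMeasure] [μ.InnerRegular] {A : Set V} (hA : MeasurableSet A)
    (h : 0 < μ A) : ∀ᶠ v in 𝓝 (0 : V), μ (A ∩ (v +ᵥ A)) ≠ 0 := by
  obtain ⟨k, hkA, hk, hkpos⟩ := hA.exists_lt_isCompact h
  have h_lim := tendsto_measure_vadd_sdiff_isCompact_isClosed (μ := μ) hk hk.isClosed
  filter_upwards [h_lim.eventually_lt_const hkpos] with v hv
  intro h_null
  have h_inter : μ (k ∩ (v +ᵥ k)) = 0 :=
    measure_mono_null (Set.inter_subset_inter hkA (Set.vadd_set_mono hkA))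
      h_null
  refine hv.not_ge ?_
  calc μ k = μ (v +ᵥ k) := (measure_vadd μ v k).symm
    _ ≤ μ ((v +ᵥ k) \ k) + μ (k ∩ (v +ᵥ k)) := by
      rw [Set.inter_comm]
      exact (measure_le_inter_add_sdiff μ _ k).trans_eq (add_comm _ _)
    _ = μ ((v +ᵥ k) \ k) := by rw [h_inter, add_zero]

section Towers

variable {G X : Type*} [Group G] [MulAction G X] [MeasurableSpace X]

/-- `A` can be approximated by unions of levels of the towers with bases `B n` and shapes `F n`. -/
def IsApproximable (μ : Measure X) (B : ℕ → Set X) (F : ℕ → Finset G) (A : Set X) : Prop :=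
  ∀ ε : ℝ≥0∞, 0 < ε → ∀ᶠ n in atTop, ∃ S ⊆ F n, μ (A ∆ ⋃ f ∈ S, f • B n) ≤ ε

variable {μ : Measure X} {B : ℕ → Set X} {F : ℕ → Finset G} {A A' : Set X}

theorem isApproximable_empty : IsApproximable μ B F ∅ := fun _ _ =>
  .of_forall fun _ => ⟨∅, Finset.empty_subset _, by simp⟩

theorem IsApproximable.union (hA : IsApproximable μ B F A) (hA' : IsApproximable μ B F A') :
    IsApproximable μ B F (A ∪ A') := by
  classical
  intro ε hε
  have h_half : 0 < ε / 2 := ENNReal.half_pos hε.ne'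
  filter_upwards [hA _ h_half, hA' _ h_half] with n ⟨S, hS, h⟩ ⟨S', hS', h'⟩
  refine ⟨S ∪ S', Finset.union_subset hS hS', ?_⟩
  rw [Finset.set_biUnion_union]
  calc _ ≤ _ := measure_mono (Set.union_symmDiff_union_subset ..)
    _ ≤ _ := measure_union_le _ _
    _ ≤ ε / 2 + ε / 2 := add_le_add h h'
    _ = ε := ENNReal.add_halves ε

theorem isApproximable_biUnion {ι : Type*} (s : Finset ι) {A : ι → Set X}
    (h : ∀ i, IsApproximable μ B F (A i)) : IsApproximable μ B F (⋃ i ∈ s, A i) := by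
  classical
  induction s using Finset.induction_on with
  | empty => simpa using isApproximable_empty
  | insert i s _ ih =>
    rw [Finset.set_biUnion_insert]
    exact (h i).union ih

theorem isApproximable_of_forall_exists
    (h : ∀ ε : ℝ≥0∞, 0 < ε → ∃ A', IsApproximable μ B F A' ∧ μ (A ∆ A') ≤ ε) :
    IsApproximable μ B F A := by
  intro ε hε
  have h_half : 0 < ε / 2 := ENNReal.half_pos hε.ne'
  obtain ⟨A', hA', h_diff⟩ := h _ h_half
  filter_upwards [hA' _ h_half] with n ⟨S, hS, h_levels⟩
  refine ⟨S, hS, ?_⟩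
  calc _ ≤ _ := measure_symmDiff_le A A' _
    _ ≤ ε / 2 + ε / 2 := add_le_add h_diff h_levels
    _ = ε := ENNReal.add_halves ε

theorem isApproximable_of_forall_subset_smul [Countable G] [MeasurableConstSMul G X] {K : Set X}
    (hK : MeasurableSet K) (h_null : μ (⋃ g : G, g • K)ᶜ = 0)
    (h : ∀ (g : G) (A : Set X), MeasurableSet A → A ⊆ g • K → IsApproximable μ B F A)
    (hA : MeasurableSet A) (hA' : μ A ≠ ∞) : IsApproximable μ B F A := by
  refine isApproximable_of_forall_exists fun ε hε => ?_
  obtain ⟨s, hs⟩ :=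
    exists_finset_measure_diff_iUnion_le hA hA' (fun g : G => hK.const_smul g) h_null hε
  refine ⟨⋃ g ∈ s, A ∩ g • K, isApproximable_biUnion s fun g =>
    h g _ (hA.inter (hK.const_smul g)) Set.inter_subset_right, ?_⟩
  rwa [← Set.inter_iUnion₂, Set.symmDiff_def, Set.sdiff_self_inter,
    Set.sdiff_eq_empty.2 Set.inter_subset_left, Set.union_empty]

theorem IsApproximable.exists_tendsto (hA : IsApproximable μ B F A) :
    ∃ S : ℕ → Finset G, (∀ n, S n ⊆ F n) ∧
      Tendsto (fun n => μ (A ∆ ⋃ f ∈ S n, f • B n)) atTop (𝓝 0) := by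
  have h_min (n : ℕ) := Finset.exists_min_image (F n).powerset
    (fun S => μ (A ∆ ⋃ f ∈ S, f • B n)) ⟨∅, Finset.empty_mem_powerset _⟩
  choose S hS h_min using h_min
  refine ⟨S, fun n => Finset.mem_powerset.1 (hS n), ENNReal.tendsto_nhds_zero.2 fun ε hε => ?_⟩
  filter_upwards [hA ε hε] with n ⟨T, hT, h⟩
  exact (h_min n T (Finset.mem_powerset.2 hT)).trans h

end Towers

theorem isFolnerSequence_of_tendsto_card_div {G : Type*} [Group G] {F : ℕ → Finset G}
    (hF : ∀ n, (F n).Nonempty)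
    (h : ∀ g : G, ∃ I : ℕ → Finset G, (∀ᶠ n in atTop, I n ⊆ F n ∧ ∀ f ∈ I n, g * f ∈ F n) ∧
      Tendsto (fun n => ((I n).card / (F n).card : ℝ)) atTop (𝓝 1)) :
    IsFolnerSequence F := by
  classical
  let _ : MeasurableSpace G := ⊤
  refine ⟨.of_forall fun _ => trivial, .of_forall fun n => ?_, .of_forall fun n => ?_, fun g => ?_⟩
  · simpa [Measure.count_apply_finset] using (hF n).ne_empty
  · simp
  obtain ⟨I, hI, h_lim⟩ := h g
  have h_bound : Tendsto (fun n => ENNReal.ofReal (2 * (1 - (I n).card / (F n).card : ℝ))) atTop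
      (𝓝 0) := by
    simpa using ENNReal.tendsto_ofReal ((h_lim.const_sub 1).const_mul 2)
  refine tendsto_of_tendsto_of_tendsto_of_le_of_le' tendsto_const_nhds h_bound
    (.of_forall fun _ => zero_le) ?_
  filter_upwards [hI] with n ⟨h_sub, h_mul⟩
  have h_pos : (0 : ℝ) < (F n).card := mod_cast (hF n).card_pos
  have h_inter : (I n).card ≤ (g • F n ∩ F n).card := by
    rw [← Finset.card_smul_finset g (I n)]
    refine Finset.card_le_card
      (Finset.subset_inter (Finset.smul_finset_subset_smul_finset h_sub) fun _ hx => ?_)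
    obtain ⟨f, hf, rfl⟩ := Finset.mem_smul_finset.1 hx
    exact h_mul f hf
  have h_card : (((g • F n) ∆ F n).card : ℝ) ≤ 2 * ((F n).card - (I n).card) := by
    have h₁ := Finset.card_sdiff_add_card_inter (g • F n) (F n)
    have h₂ := Finset.card_sdiff_add_card_inter (F n) (g • F n)
    rw [Finset.card_smul_finset] at h₁
    rw [Finset.inter_comm] at h₂
    rw [Finset.symmDiff_def, Finset.card_union_of_disjoint disjoint_sdiff_sdiff]
    rify at h_inter h₁ h₂ ⊢
    linarith
  rw [← Finset.coe_smul_finset, ← Finset.coe_symmDiff, Measure.count_apply_finset,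
    Measure.count_apply_finset, ← ENNReal.ofReal_natCast, ← ENNReal.ofReal_natCast (F n).card,
    ← ENNReal.ofReal_div_of_pos h_pos]
  refine ENNReal.ofReal_le_ofReal ((div_le_iff₀ h_pos).2 (h_card.trans_eq ?_))
  rw [mul_assoc, sub_mul, one_mul, div_mul_cancel₀ _ h_pos.ne']

/-! ### The action -/

instance : MulAction H3Z (Heis ℤ_[2]) := .compHom _ (embed ℤ_[2])

theorem smul_ne_self {γ : H3Z} (hγ : γ ≠ 1) (p : Heis ℤ_[2]) : γ • p ≠ p := fun h =>
  hγ <| embed_injective (R := ℤ_[2]) <| by rw [map_one]; exact mul_eq_right.1 h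

instance : MeasurableConstSMul H3Z (Heis ℤ_[2]) where
  measurable_const_smul γ := (continuous_const_mul (embed ℤ_[2] γ)).measurable

/-- Sequences of binary digits, a compact group under digitwise addition. -/
abbrev Digits : Type := ℕ → ZMod 2

/-- The `i`-th digit as an integer, `0` or `1`. -/
def digit (x : Digits) (i : ℕ) : ℤ := (x i).val

theorem digit_of_eq_zero {x : Digits} {i : ℕ} (h : x i = 0) : digit x i = 0 := by
  rw [digit, h, ZMod.val_zero, Nat.cast_zero]

theorem intCast_digit (x : Digits) (i : ℕ) : (digit x i : ZMod 2) = x i := by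
  rw [digit, Int.cast_natCast, ZMod.natCast_zmod_val]

theorem abs_digit_sub_le (x y : Digits) (i : ℕ) : |(digit y - digit x) i| ≤ 1 := by
  have hx := (x i).val_lt
  have hy := (y i).val_lt
  rw [Pi.sub_apply, digit, digit, abs_le]
  omega

theorem abs_digit_le (x : Digits) (i : ℕ) : |digit x i| ≤ 1 := by
  simpa [digit_of_eq_zero] using abs_digit_sub_le 0 x i

theorem continuous_digit : Continuous digit := continuous_pi fun i =>
  (continuous_of_discreteTopology (f := fun a : ZMod 2 => (a.val : ℤ))).comp (continuous_apply i)

/-- The point of `H₃(ℤ_[2])` with the given digits. The points form a Cantor set, which carries the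
base measure of the construction. -/
def point (x : Digits) : Heis ℤ_[2] := signedSum (digit x)

theorem smul_point_eq_iff {γ : H3Z} {x y : Digits} :
    γ • point x = point y ↔ embed ℤ_[2] γ = signedSum (digit y - digit x) := by
  rw [signedSum_sub, eq_mul_inv_iff_mul_eq]
  rfl

theorem sub_eq_sub_of_smul_point_eq {γ : H3Z} {x y x' y' : Digits} (h : γ • point x = point y)
    (h' : γ • point x' = point y') : y - x = y' - x' := by
  have h_digit : digit y - digit x - (digit y' - digit x') = 0 := by
    refine eq_zero_of_signedSum_eq_one (fun i => ?_) ?_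
    · exact (abs_sub _ _).trans (add_le_add (abs_digit_sub_le x y i) (abs_digit_sub_le x' y' i))
    · rw [signedSum_sub, ← smul_point_eq_iff.1 h, ← smul_point_eq_iff.1 h', mul_inv_cancel]
  ext i
  simpa [intCast_digit, sub_eq_zero] using congr((($h_digit i : ℤ) : ZMod 2))

theorem point_injective : Function.Injective point := fun x y h => by
  have h_one : (1 : H3Z) • point x = point y := by rw [one_smul, h]
  have h_sub := sub_eq_sub_of_smul_point_eq h_one (one_smul H3Z (point x))
  rw [sub_self, sub_eq_zero] at h_sub
  exact h_sub.symm

theorem measurableEmbedding_point : MeasurableEmbedding point :=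
  have h_cont : Continuous point := continuous_signedSum.comp continuous_digit
  (h_cont.isClosedEmbedding point_injective).measurableEmbedding

theorem eventually_eq_signedStep_of_smul_point_eq {γ : H3Z} {x y : Digits}
    (h : γ • point x = point y) : ∀ᶠ n in atTop, γ = signedStep n (digit y - digit x) :=
  eventually_eq_signedStep (abs_digit_sub_le x y) (smul_point_eq_iff.1 h)

/-- The invariant measure on `H₃(ℤ_[2])` which extends Haar measure on the digits. -/
def measure : Measure (Heis ℤ_[2]) :=
  translatesSup H3Z ((Measure.addHaar : Measure Digits).map point)

instance : SMulInvariantMeasure H3Z (Heis ℤ_[2]) measure :=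
  inferInstanceAs (SMulInvariantMeasure _ _ (translatesSup H3Z _))

theorem measure_image_point (s : Set Digits) : measure (point '' s) = Measure.addHaar s := by
  refine translatesSup_image measurableEmbedding_point (fun γ => ?_) s
  by_cases h : ∃ x y, γ • point x = point y
  · obtain ⟨x₀, y₀, h₀⟩ := h
    exact ⟨(y₀ - x₀ + ·), measurePreserving_add_left _ _, fun x y hxy =>
      sub_eq_iff_eq_add.1 (sub_eq_sub_of_smul_point_eq hxy h₀)⟩
  · exact ⟨id, .id _, fun x y hxy => (h ⟨x, y, hxy⟩).elim⟩

theorem measure_compl_iUnion_smul_range :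
    measure (⋃ γ : H3Z, γ • Set.range point)ᶜ = 0 := by
  refine translatesSup_compl_eq_zero ?_
  rw [measurableEmbedding_point.map_apply, Set.preimage_compl, Set.preimage_range, Set.compl_univ,
    measure_empty]

theorem measure_range_point :
    measure (Set.range point) = Measure.addHaar (Set.univ : Set Digits) := by
  rw [← Set.image_univ, measure_image_point]

instance : SigmaFinite measure :=
  sigmaFinite_of_measure_compl_iUnion_smul_eq_zero (G := H3Z)
    (measure_range_point.trans_lt (measure_lt_top _ _)) measure_compl_iUnion_smul_range

theorem coords_y_eq_zero_of_smul_point_eq {γ : H3Z} {x y : Digits} (h : γ • point x = point y) :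
    (H3Z.coords γ).y = 0 := by
  have h_y : ((H3Z.coords γ).y : ℤ_[2]) = 0 := congr(($(smul_point_eq_iff.1 h)).y)
  exact_mod_cast h_y

theorem measure_univ : measure Set.univ = ∞ := by
  refine measure_univ_eq_top_of_pairwise_disjoint_smul (G := H3Z)
    (g := fun b : ℤ => H3Z.coords.symm ⟨0, b, 0⟩)
    measurableEmbedding_point.measurableSet_range ?_ fun b c hbc => Set.disjoint_left.2 ?_
  · rw [measure_range_point]
    exact (isOpen_univ.measure_pos _ Set.univ_nonempty).ne'
  · rintro _ ⟨_, ⟨x, rfl⟩, rfl⟩ ⟨_, ⟨y, rfl⟩, h⟩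
    have h_smul : ((H3Z.coords.symm ⟨0, b, 0⟩)⁻¹ * H3Z.coords.symm ⟨0, c, 0⟩) • point y =
        point x := by
      rw [mul_smul, inv_smul_eq_iff]
      exact h
    have h_y := coords_y_eq_zero_of_smul_point_eq h_smul
    simp only [map_mul, map_inv, MulEquiv.apply_symm_apply, Heis.mul_y, Heis.inv_y] at h_y
    omega

/-! ### Rank one -/

/-- The elements of `H₃(ℤ)` with `|x| < r`, `|y| < s` and `|z| < r`. -/
def box (r s : ℤ) : Finset H3Z :=
  (Finset.Ioo (-r) r ×ˢ Finset.Ioo (-s) s ×ˢ Finset.Ioo (-r) r).map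
    (Heis.equivProd.symm.trans H3Z.coords.symm.toEquiv).toEmbedding

theorem mem_box {r s : ℤ} {γ : H3Z} : γ ∈ box r s ↔
    |(H3Z.coords γ).x| < r ∧ |(H3Z.coords γ).y| < s ∧ |(H3Z.coords γ).z| < r := by
  rw [box, Finset.mem_map_equiv]
  simp [Heis.equivProd, abs_lt]

theorem card_box {r s : ℤ} (hr : 0 < r) (hs : 0 < s) :
    ((box r s).card : ℝ) = (2 * r - 1) ^ 2 * (2 * s - 1) := by
  have h_card : ((box r s).card : ℤ) = (2 * r - 1) ^ 2 * (2 * s - 1) := by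
    simp only [box, Finset.card_map, Finset.card_product, Int.card_Ioo, Nat.cast_mul]
    rw [Int.toNat_of_nonneg (by omega), Int.toNat_of_nonneg (by omega)]
    ring
  exact_mod_cast h_card

theorem box_subset_box {r s r' s' : ℤ} (hr : r ≤ r') (hs : s ≤ s') : box r s ⊆ box r' s' :=
  fun _ h => by
    rw [mem_box] at h ⊢
    exact ⟨h.1.trans_le hr, h.2.1.trans_le hs, h.2.2.trans_le hr⟩

theorem mul_mem_box (γ : H3Z) {δ : H3Z} {r s : ℤ} (hδ : δ ∈ box r s) :
    γ * δ ∈ box (r + |(H3Z.coords γ).x| * s + |(H3Z.coords γ).z|) (s + |(H3Z.coords γ).y|) := by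
  obtain ⟨hx, hy, hz⟩ := mem_box.1 hδ
  have hs : 1 ≤ s := (abs_nonneg _).trans_lt hy
  simp only [mem_box, map_mul, Heis.mul_x, Heis.mul_y, Heis.mul_z]
  refine ⟨(abs_add_le _ _).trans_lt ?_, (abs_add_le _ _).trans_lt ?_,
    (abs_add_three _ _ _).trans_lt ?_⟩
  · nlinarith [abs_nonneg (H3Z.coords γ).x, abs_nonneg (H3Z.coords γ).z]
  · linarith
  · rw [abs_mul]
    nlinarith [abs_nonneg (H3Z.coords γ).x]

/-- The shape of the `n`-th Rokhlin tower. -/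
def towerBox (n : ℕ) : Finset H3Z := box (halfScale n) (n + 1)

theorem sq_le_halfScale (n : ℕ) : ((n : ℤ) + 1) ^ 2 ≤ halfScale n := by
  have h : (n : ℤ) + 1 ≤ 2 ^ n := mod_cast Nat.lt_two_pow_self (n := n)
  calc ((n : ℤ) + 1) ^ 2 ≤ (2 ^ n) ^ 2 := by gcongr
    _ = 2 ^ (n * 2) := (pow_mul ..).symm
    _ ≤ 2 ^ (n * (n + 2)) := pow_le_pow_right₀ one_le_two (by nlinarith)

theorem tendsto_div_two_mul_halfScale_sub_one :
    Tendsto (fun n : ℕ => ((n : ℝ) + 1) / (2 * halfScale n - 1)) atTop (𝓝 0) := by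
  refine squeeze_zero (fun n => ?_) (fun n => ?_) tendsto_one_div_add_atTop_nhds_zero_nat
  all_goals
    have h_sq : ((n : ℝ) + 1) ^ 2 ≤ halfScale n := mod_cast sq_le_halfScale n
    have h_pos : (0 : ℝ) < 2 * halfScale n - 1 := by nlinarith [n.cast_nonneg (α := ℝ)]
  · positivity
  · rw [div_le_div_iff₀ h_pos (by positivity)]
    nlinarith

theorem tendsto_card_box_div_card_towerBox (b c : ℤ) :
    Tendsto (fun n : ℕ => ((box (halfScale n - c * (n + 1)) (n + 1 - b)).card /
      (towerBox n).card : ℝ)) atTop (𝓝 1) := by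
  have h_lim : Tendsto (fun n : ℕ => (1 - 2 * c * (((n : ℝ) + 1) / (2 * halfScale n - 1))) ^ 2 *
      (1 - 2 * b * (1 / (2 * n + 1)))) atTop
      (𝓝 ((1 - 2 * (c : ℝ) * 0) ^ 2 * (1 - 2 * (b : ℝ) * 0))) := by
    refine ((tendsto_div_two_mul_halfScale_sub_one.const_mul _).const_sub _).pow _ |>.mul ?_
    refine (Tendsto.const_mul _ ?_).const_sub _
    exact tendsto_const_nhds.div_atTop
      (tendsto_atTop_add_const_right _ _ (tendsto_natCast_atTop_atTop.const_mul_atTop two_pos))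
  norm_num at h_lim
  refine h_lim.congr' ?_
  filter_upwards [eventually_ge_atTop (b.toNat + c.toNat)] with n hn
  have h_sq := sq_le_halfScale n
  have h_pos : (0 : ℝ) < 2 * halfScale n - 1 := by
    have : 0 < 2 * halfScale n - 1 := by nlinarith
    exact_mod_cast this
  rw [towerBox, card_box (by nlinarith [Int.self_le_toNat c]) (by omega),
    card_box (by nlinarith) (by omega)]
  push_cast
  have h_odd : 2 * ((n : ℝ) + 1) - 1 = 2 * n + 1 := by ring
  rw [h_odd]
  field_simp
  ring

theorem isFolnerSequence_towerBox : IsFolnerSequence towerBox := by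
  refine isFolnerSequence_of_tendsto_card_div (fun n => ⟨1, mem_box.2 ?_⟩) fun γ =>
    ⟨_, .of_forall fun n => ⟨?_, fun δ hδ => ?_⟩, tendsto_card_box_div_card_towerBox
      |(H3Z.coords γ).y| (|(H3Z.coords γ).x| + |(H3Z.coords γ).z|)⟩
  · have h_pos : 0 < halfScale n := (Int.natCast_nonneg n).trans_lt (lt_halfScale n)
    simp only [map_one, Heis.one_x, Heis.one_y, Heis.one_z, abs_zero]
    omega
  · refine box_subset_box ?_ (by linarith [abs_nonneg (H3Z.coords γ).y])
    have : 0 ≤ (|(H3Z.coords γ).x| + |(H3Z.coords γ).z|) * ((n : ℤ) + 1) := by positivity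
    linarith
  · refine box_subset_box ?_ (by linarith) (mul_mem_box γ hδ)
    have h_x : 0 ≤ |(H3Z.coords γ).x| * |(H3Z.coords γ).y| := by positivity
    have h_z : 0 ≤ |(H3Z.coords γ).z| * (n : ℤ) := by positivity
    linarith

theorem signedStep_congr {η θ : ℕ → ℤ} {n : ℕ} (h : ∀ i < n, η i = θ i) :
    signedStep n η = signedStep n θ := by
  have h_sum (d : ℕ → ℤ) : partialSum (η * d) n = partialSum (θ * d) n :=
    Finset.sum_congr rfl fun i hi => by
      rw [Pi.mul_apply, Pi.mul_apply, h i (Finset.mem_range.1 hi)]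
  rw [signedStep, signedStep, h_sum, h_sum]

theorem signedStep_mem_box {η : ℕ → ℤ} (hη : ∀ i, |η i| ≤ 1) {n : ℕ} {c : ℤ} (hc : 2 * c < n) :
    signedStep n η ∈ box (halfScale n - c) 1 := by
  have h_sum {d : ℕ → ℤ} (hd : ∀ i : ℕ, |d i| ≤ i + 1) :
      |partialSum (η * d) n| < halfScale n - c := by
    have h_le := mul_abs_partialSum_le (abs_mul_le_of_abs_le_one hη hd) n
    nlinarith [lt_halfScale n, abs_nonneg (partialSum (η * d) n)]
  rw [mem_box, coords_signedStep]
  exact ⟨h_sum abs_dirX_le, by simp, h_sum abs_dirZ_le⟩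

theorem eventually_mul_signedStep_mem_towerBox (γ : H3Z) :
    ∀ᶠ n in atTop, ∀ x, γ * signedStep n (digit x) ∈ towerBox n := by
  filter_upwards [eventually_gt_atTop (2 * (|(H3Z.coords γ).x| + |(H3Z.coords γ).z|)).toNat,
    eventually_gt_atTop |(H3Z.coords γ).y|.toNat] with n hxz hy x
  have h_step := signedStep_mem_box (abs_digit_le x) (Int.lt_of_toNat_lt hxz)
  exact box_subset_box (by linarith) (by omega) (mul_mem_box γ h_step)

/-- The digit sequences whose first `n` digits vanish. -/
def zeroBelow (n : ℕ) : Set Digits := {x | ∀ i < n, x i = 0}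

/-- The base of the `n`-th Rokhlin tower. -/
def base (n : ℕ) : Set (Heis ℤ_[2]) := point '' zeroBelow n

theorem isOpen_zeroBelow (n : ℕ) : IsOpen (zeroBelow n) := by
  have h_eq : zeroBelow n = Set.pi (Set.Iio n) fun _ => {0} := by ext; simp [zeroBelow]
  rw [h_eq]
  exact isOpen_set_pi (Set.finite_Iio n) fun _ _ => isOpen_discrete _

theorem measurableSet_base (n : ℕ) : MeasurableSet (base n) :=
  measurableEmbedding_point.measurableSet_image.2 (isOpen_zeroBelow n).measurableSet

theorem measure_base_pos (n : ℕ) : 0 < measure (base n) := by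
  rw [base, measure_image_point]
  exact (isOpen_zeroBelow n).measure_pos _ ⟨0, fun _ _ => rfl⟩

theorem measure_base_lt_top (n : ℕ) : measure (base n) < ∞ := by
  rw [base, measure_image_point]
  exact measure_lt_top _ _

theorem scale_dvd_of_smul_point_eq {n : ℕ} {γ : H3Z} {x y : Digits} (hx : x ∈ zeroBelow n)
    (hy : y ∈ zeroBelow n) (h : γ • point x = point y) :
    scale n ∣ (H3Z.coords γ).x ∧ scale n ∣ (H3Z.coords γ).z := by
  obtain ⟨N, rfl⟩ := (eventually_eq_signedStep_of_smul_point_eq h).exists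
  have h_dvd (d : ℕ → ℤ) : scale n ∣ partialSum ((digit y - digit x) * d) N :=
    scale_dvd_partialSum (fun i hi => by
      simp [digit_of_eq_zero (hx i hi), digit_of_eq_zero (hy i hi)]) N
  rw [coords_signedStep]
  exact ⟨h_dvd dirX, h_dvd dirZ⟩

theorem pairwiseDisjoint_smul_base (n : ℕ) :
    (towerBox n : Set H3Z).PairwiseDisjoint fun f => f • base n := by
  intro γ hγ δ hδ hne
  refine Set.disjoint_left.2 ?_
  rintro _ ⟨_, ⟨x, hx, rfl⟩, rfl⟩ ⟨_, ⟨y, hy, rfl⟩, h⟩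
  have h_smul : (γ⁻¹ * δ) • point y = point x := by
    rw [mul_smul, inv_smul_eq_iff]
    exact h
  have h_y := coords_y_eq_zero_of_smul_point_eq h_smul
  obtain ⟨hγx, -, hγz⟩ := mem_box.1 hγ
  obtain ⟨hδx, -, hδz⟩ := mem_box.1 hδ
  obtain ⟨h_x, h_z⟩ := scale_dvd_of_smul_point_eq hy hx h_smul
  simp only [map_mul, map_inv, Heis.mul_x, Heis.mul_y, Heis.mul_z, Heis.inv_x, Heis.inv_y,
    Heis.inv_z, neg_add_eq_zero] at h_x h_y h_z
  have h_eq_of_dvd {a b : ℤ} (ha : |a| < halfScale n) (hb : |b| < halfScale n)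
      (h_dvd : scale n ∣ b - a) : a = b := by
    refine (sub_eq_zero.1 (Int.eq_zero_of_abs_lt_dvd h_dvd ?_)).symm
    linarith [abs_sub b a, scale_eq n]
  refine hne (H3Z.coords.injective (Heis.ext (h_eq_of_dvd hγx hδx ?_) h_y
    (h_eq_of_dvd hγz hδz ?_)))
  · rwa [← neg_add_eq_sub]
  · rw [← h_y] at h_z
    ring_nf at h_z ⊢
    exact h_z

theorem signedStep_smul_point {n : ℕ} (x : Digits) {y : Digits} (hy : y ∈ zeroBelow n) :
    signedStep n (digit x) • point y = point ((Set.Iio n).piecewise x y) := by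
  rw [smul_point_eq_iff, signedSum_eq_embed (n := n) fun i hi => ?_,
    signedStep_congr fun i hi => ?_]
  · simp [digit, Set.piecewise_eq_of_mem _ _ _ (Set.mem_Iio.2 hi), hy i hi]
  · simp [digit, Set.piecewise_eq_of_notMem _ _ _ (Set.notMem_Iio.2 hi)]

theorem exists_piecewise_eq (n : ℕ) (x : Digits) :
    ∃ y ∈ zeroBelow n, (Set.Iio n).piecewise x y = x := by
  refine ⟨(Set.Iio n).piecewise 0 x, fun i hi => Set.piecewise_eq_of_mem _ _ _ hi, ?_⟩
  ext i
  by_cases hi : i < n <;> simp [hi]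

theorem eventually_smul_image_eq_biUnion {C : Set Digits} {m : ℕ}
    (hC : DependsOn (· ∈ C) (Set.Iio m)) (γ : H3Z) :
    ∀ᶠ n in atTop, ∃ S ⊆ towerBox n, γ • point '' C = ⋃ f ∈ S, f • base n := by
  classical
  filter_upwards [eventually_mul_signedStep_mem_towerBox γ, eventually_ge_atTop m] with n hn hm
  refine ⟨(towerBox n).filter fun f => f • base n ⊆ γ • point '' C, Finset.filter_subset _ _,
    Set.Subset.antisymm ?_ (Set.iUnion₂_subset fun f hf => (Finset.mem_filter.1 hf).2)⟩
  rintro _ ⟨_, ⟨x, hx, rfl⟩, rfl⟩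
  have h_level : (γ * signedStep n (digit x)) • base n ⊆ γ • point '' C := by
    rintro _ ⟨_, ⟨y, hy, rfl⟩, rfl⟩
    dsimp only
    rw [mul_smul, signedStep_smul_point x hy]
    refine Set.smul_mem_smul_set (Set.mem_image_of_mem _ ((hC fun i hi => ?_).mpr hx))
    exact Set.piecewise_eq_of_mem _ _ _ (lt_of_lt_of_le hi hm)
  obtain ⟨y, hy, hxy⟩ := exists_piecewise_eq n x
  refine Set.mem_biUnion (Finset.mem_filter.2 ⟨hn x, h_level⟩) ⟨point y, ⟨y, hy, rfl⟩, ?_⟩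
  dsimp only
  rw [mul_smul, signedStep_smul_point x hy, hxy]

theorem exists_dependsOn_measure_symmDiff_le (ν : Measure Digits) [IsFiniteMeasure ν]
    {D : Set Digits} (hD : MeasurableSet D) {ε : ℝ≥0∞} (hε : 0 < ε) :
    ∃ m C, DependsOn (· ∈ C) (Set.Iio m) ∧ ν (D ∆ C) ≤ ε := by
  have h_dense := Measure.MeasureDense.of_generateFrom_isSetAlgebra_finite ν
    isSetAlgebra_measurableCylinders generateFrom_measurableCylinders.symm
  obtain ⟨δ, hδ, hδε⟩ := ENNReal.lt_iff_exists_nnreal_btwn.1 hε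
  obtain ⟨C, hC, h_lt⟩ := h_dense.approx D hD (measure_ne_top _ _) δ (by exact_mod_cast hδ)
  rw [ENNReal.ofReal_coe_nnreal] at h_lt
  obtain ⟨s, S, -, rfl⟩ := (mem_measurableCylinders _).1 hC
  refine ⟨s.sup id + 1, _, fun x y hxy => ?_, (h_lt.trans hδε).le⟩
  simp only [mem_cylinder]
  congr! 1
  ext i
  exact hxy i (Nat.lt_succ_of_le (Finset.le_sup (f := id) i.2))

theorem isApproximable_smul_image {D : Set Digits} (hD : MeasurableSet D) (γ : H3Z) :
    IsApproximable measure base towerBox (γ • point '' D) := by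
  refine isApproximable_of_forall_exists fun ε hε => ?_
  obtain ⟨m, C, hC, h_le⟩ := exists_dependsOn_measure_symmDiff_le Measure.addHaar hD hε
  refine ⟨γ • point '' C, fun δ _ => ?_, ?_⟩
  · filter_upwards [eventually_smul_image_eq_biUnion hC γ] with n ⟨S, hS, h_eq⟩
    exact ⟨S, hS, by simp [h_eq]⟩
  · rwa [← Set.smul_set_symmDiff, measure_smul, ← Set.image_symmDiff point_injective,
      measure_image_point]

theorem isApproximable_of_subset_smul_range {γ : H3Z} {A : Set (Heis ℤ_[2])}
    (hA : MeasurableSet A) (h : A ⊆ γ • Set.range point) :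
    IsApproximable measure base towerBox A := by
  have h_eq : A = γ • point '' (point ⁻¹' (γ⁻¹ • A)) := by
    rw [Set.image_preimage_eq_of_subset, smul_inv_smul]
    rwa [← Set.subset_smul_set_iff]
  rw [h_eq]
  exact isApproximable_smul_image (measurableEmbedding_point.measurable (hA.const_smul γ⁻¹)) γ

theorem isRankOne_measure : IsRankOne H3Z measure :=
  ⟨base, towerBox, isFolnerSequence_towerBox,
    fun n => ⟨measurableSet_base n, measure_base_pos n, measure_base_lt_top n⟩,
    pairwiseDisjoint_smul_base, fun _ hA hA' =>
      (isApproximable_of_forall_subset_smul measurableEmbedding_point.measurableSet_range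
        measure_compl_iUnion_smul_range
        (fun _ _ => isApproximable_of_subset_smul_range) hA hA'.ne).exists_tendsto⟩

/-! ### Recurrence -/

/-- The translation which turns the `i`-th digit of a point from `0` to `1`. -/
def singleStep (i : ℕ) : H3Z := H3Z.coords.symm ⟨scale i * dirX i, 0, scale i * dirZ i⟩

theorem singleStep_ne_one (i : ℕ) : singleStep i ≠ 1 := by
  rw [singleStep, ne_eq, EmbeddingLike.map_eq_one_iff, Heis.ext_iff]
  obtain h | ⟨l, h⟩ := direction_cases i <;> simp [dirX, dirZ, h, (scale_pos i).ne']

theorem coords_conj_singleStep (g : H3Z) (i : ℕ) : H3Z.coords (g * singleStep i * g⁻¹) =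
    ⟨scale i * dirX i, 0, scale i * dirZ i - (H3Z.coords g).y * (scale i * dirX i)⟩ := by
  ext <;>
    simp only [singleStep, map_mul, map_inv, MulEquiv.apply_symm_apply, Heis.mul_x, Heis.mul_y,
      Heis.mul_z, Heis.inv_x, Heis.inv_y, Heis.inv_z] <;>
    ring

theorem singleStep_smul_point {x : Digits} {i : ℕ} (h : x i = 0) :
    singleStep i • point x = point (x + Pi.single i 1) := by
  have h_digit : digit (x + Pi.single i 1) - digit x = Pi.single i 1 := by
    ext j
    obtain rfl | hj := eq_or_ne j i
    · simp [digit, h, ZMod.val_one]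
    · simp [digit, hj]
  have h_step : singleStep i = signedStep (i + 1) (Pi.single i 1) := by
    have h_sum (d : ℕ → ℤ) : partialSum (Pi.single i 1 * d) (i + 1) = scale i * d i := by
      rw [partialSum_succ, partialSum_eq_zero fun j hj => by simp [hj.ne]]
      simp
    rw [singleStep, signedStep, h_sum, h_sum]
  rw [smul_point_eq_iff, h_digit, h_step, signedSum_eq_embed]
  exact fun j hj => Pi.single_eq_of_ne (by omega) _

theorem singleStep_smul_point_or (x : Digits) (i : ℕ) :
    singleStep i • point x = point (x + Pi.single i 1) ∨
      singleStep i • point (x + Pi.single i 1) = point x := by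
  obtain h | h : x i = 0 ∨ x i = 1 := by generalize x i = a; decide +revert
  · exact .inl (singleStep_smul_point h)
  · right
    rw [singleStep_smul_point (by simp [h, CharTwo.add_self_eq_zero]), add_assoc,
      CharTwo.add_self_eq_zero, add_zero]

theorem tendsto_single_one : Tendsto (fun i => (Pi.single i 1 : Digits)) atTop (𝓝 0) := by
  refine tendsto_pi_nhds.2 fun j => tendsto_const_nhds.congr' ?_
  filter_upwards [eventually_gt_atTop j] with i hi
  rw [Pi.single_eq_of_ne hi.ne, Pi.zero_apply]

theorem measure_inter_singleStep_smul_ne_zero {A : Set (Heis ℤ_[2])} {i : ℕ}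
    (h : (Measure.addHaar : Measure Digits)
      (point ⁻¹' A ∩ ((Pi.single i 1 : Digits) +ᵥ point ⁻¹' A)) ≠ 0) :
    measure (A ∩ singleStep i • A) ≠ 0 := by
  contrapose! h
  rw [← measure_image_point]
  refine measure_mono_null ?_ (measure_union_null h
    ((measure_smul measure (singleStep i)⁻¹ (A ∩ singleStep i • A)).trans h))
  rintro _ ⟨_, ⟨hx, y, hy, rfl⟩, rfl⟩
  simp only [vadd_eq_add, Set.mem_preimage, add_comm (Pi.single i 1)] at hx hy ⊢
  obtain h_step | h_step := singleStep_smul_point_or y i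
  · exact .inl ⟨hx, point y, hy, h_step⟩
  · right
    rw [Set.mem_inv_smul_set_iff, h_step]
    exact ⟨hy, _, hx, h_step⟩

theorem exists_eventually_measure_inter_conj_smul_pos {A : Set (Heis ℤ_[2])}
    (hA : MeasurableSet A) (h : 0 < measure A) :
    ∃ g : H3Z, ∀ᶠ i in atTop, 0 < measure (A ∩ (g * singleStep i * g⁻¹) • A) := by
  obtain ⟨g, hg⟩ := exists_measure_inter_smul_pos (G := H3Z) measure_compl_iUnion_smul_range h
  have h_pos : 0 < (Measure.addHaar : Measure Digits) (point ⁻¹' (g⁻¹ • A)) := by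
    rwa [← measure_image_point, Set.image_preimage_eq_inter_range, ← measure_smul measure g,
      Set.smul_set_inter, smul_inv_smul]
  have h_meas : MeasurableSet (point ⁻¹' (g⁻¹ • A)) :=
    measurableEmbedding_point.measurable (hA.const_smul g⁻¹)
  refine ⟨g, ?_⟩
  filter_upwards [tendsto_single_one.eventually
    (eventually_measure_inter_vadd_ne_zero h_meas h_pos)] with i hi
  have h_ne := measure_inter_singleStep_smul_ne_zero hi
  rw [← measure_smul measure g, Set.smul_set_inter, smul_inv_smul, smul_smul, smul_smul] at h_ne
  exact h_ne.bot_lt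

theorem isRecurrentAlong_of_frequently_mem_expLine (m : MetricSpace H3R) {θ : ℙ ℝ h3}
    (h : ∀ g : H3Z, ∃ᶠ i in atTop, ((g * singleStep i * g⁻¹ : H3Z) : H3R) ∈ expLine θ) :
    IsRecurrentAlong m measure θ := by
  intro ε hε A hA hA_pos
  obtain ⟨g, hg⟩ := exists_eventually_measure_inter_conj_smul_pos hA hA_pos
  obtain ⟨i, h_mem, h_pos⟩ := ((h g).and_eventually hg).exists
  refine ⟨_, conj_eq_one_iff.not.2 (singleStep_ne_one i), _, h_mem, ?_, h_pos⟩
  rwa [@dist_self _ m.toPseudoMetricSpace]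

theorem isRecurrentAlong_thetaLine (m : MetricSpace H3R) (l : ℤ) :
    IsRecurrentAlong m measure (thetaLine l) := by
  refine isRecurrentAlong_of_frequently_mem_expLine m fun g => frequently_atTop.2 fun N => ?_
  obtain ⟨i, hi, h_dir⟩ := exists_ge_direction_eq_one (l + (H3Z.coords g).y) N
  refine ⟨i, hi, mem_expLine_thetaLine.2 ⟨scale i, ?_⟩⟩
  rw [H3R.coords_coe, coords_conj_singleStep]
  ext
  · simp [dirX, h_dir]
  · simp
  · simp only [Heis.map_apply_z, dirX, dirZ, h_dir, eq_intCast]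
    push_cast
    ring

theorem isRecurrentAlong_thetaInf (m : MetricSpace H3R) : IsRecurrentAlong m measure thetaInf := by
  refine isRecurrentAlong_of_frequently_mem_expLine m fun g => frequently_atTop.2 fun N => ?_
  obtain ⟨i, hi, h_dir⟩ := exists_ge_direction_eq_zero_one N
  refine ⟨i, hi, mem_expLine_thetaInf.2 ⟨scale i, ?_⟩⟩
  rw [H3R.coords_coe, coords_conj_singleStep]
  ext <;> simp [dirX, dirZ, h_dir]

/-! ### Lines without recurrence -/

theorem exists_forall_dist_lt_abs_sub_lt_one {m : MetricSpace H3R} (hm : IsRightInvariantMetric m)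
    (t : ℝ) : ∃ ε > 0, ∀ γ : H3Z, ∀ g ∈ expLine (thetaLine t), m.dist (γ : H3R) g < ε →
      |((H3Z.coords γ).z : ℝ) - t * (H3Z.coords γ).x| < 1 := by
  have h_cont : Continuous fun k : Heis ℝ => |k.z - t * k.x| :=
    (Heis.continuous_z.sub (Heis.continuous_x.const_mul t)).abs
  have h_lim : ∀ᶠ k : Heis ℝ in 𝓝 1, |k.z - t * k.x| < 1 :=
    (h_cont.tendsto 1).eventually_lt_const (by simp)
  obtain ⟨ε, hε, h⟩ := hm.exists_forall_dist_lt h_lim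
  refine ⟨ε, hε, fun γ g hg h_dist => ?_⟩
  obtain ⟨s, hs⟩ := mem_expLine_thetaLine.1 hg
  have h_near := h _ _ h_dist
  rw [map_mul, map_inv, hs, H3R.coords_coe] at h_near
  simp only [Set.mem_ofPred_eq, Heis.mul_x, Heis.mul_z, Heis.inv_x, Heis.inv_y, Heis.inv_z,
    Heis.map_apply_x, Heis.map_apply_z, eq_intCast] at h_near
  convert h_near using 2
  ring

theorem exists_forall_dist_lt_eq_one {m : MetricSpace H3R} (hm : IsRightInvariantMetric m)
    {a c : ℝ} (h : h3.of a 1 c ≠ 0) : ∃ ε > 0, ∀ γ : H3Z, (H3Z.coords γ).y = 0 →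
      ∀ g ∈ expLine (.mk ℝ (h3.of a 1 c) h), m.dist (γ : H3R) g < ε → γ = 1 := by
  have h_cont_x : Continuous fun k : Heis ℝ => |k.x - k.y * a| :=
    (Heis.continuous_x.sub (Heis.continuous_y.mul_const a)).abs
  have h_cont_z : Continuous fun k : Heis ℝ => |k.z - k.y * c + k.y ^ 2 * a / 2 - k.x * k.y| := by
    have := Heis.continuous_x (R := ℝ)
    have := Heis.continuous_y (R := ℝ)
    have := Heis.continuous_z (R := ℝ)
    fun_prop
  have h_lim_x : ∀ᶠ k : Heis ℝ in 𝓝 1, |k.x - k.y * a| < 1 :=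
    (h_cont_x.tendsto 1).eventually_lt_const (by simp)
  have h_lim_z : ∀ᶠ k : Heis ℝ in 𝓝 1, |k.z - k.y * c + k.y ^ 2 * a / 2 - k.x * k.y| < 1 :=
    (h_cont_z.tendsto 1).eventually_lt_const (by simp)
  obtain ⟨ε, hε, h_near⟩ := hm.exists_forall_dist_lt (h_lim_x.and h_lim_z)
  refine ⟨ε, hε, fun γ hγ g hg h_dist => ?_⟩
  obtain ⟨s, hs⟩ := (mem_expLine_mk h g).1 hg
  obtain ⟨h_x, h_z⟩ := h_near _ _ h_dist
  rw [map_mul, map_inv, hs, H3R.coords_coe] at h_x h_z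
  simp only [Heis.mul_x, Heis.mul_y, Heis.mul_z, Heis.inv_x, Heis.inv_y, Heis.inv_z,
    Heis.map_apply_x, Heis.map_apply_y, Heis.map_apply_z, hγ, eq_intCast, Int.cast_zero] at h_x h_z
  have h_eq_zero {k : ℤ} {u : ℝ} (hu : |u| < 1) (hk : u = k) : k = 0 := by
    rw [hk] at hu
    exact Int.abs_lt_one_iff.1 (mod_cast hu)
  apply H3Z.coords.injective
  rw [map_one]
  exact Heis.ext (h_eq_zero h_x (by ring)) hγ (h_eq_zero h_z (by ring))

theorem abs_partialSum_dirZ_sub_le {η : ℕ → ℤ} (hη : ∀ i, |η i| ≤ 1) {t d : ℝ} (hd : 0 < d) {i : ℕ}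
    (hi : 1 + |t| ≤ i * d) :
    |(partialSum (η * dirZ) i : ℝ) - t * partialSum (η * dirX) i| ≤ d * halfScale i := by
  have h_sum {a : ℕ → ℤ} (ha : ∀ i : ℕ, |a i| ≤ i + 1) :
      i * |(partialSum (η * a) i : ℝ)| ≤ halfScale i := by
    have : ((i : ℝ) + 1) * |(partialSum (η * a) i : ℝ)| ≤ halfScale i :=
      mod_cast mul_abs_partialSum_le (abs_mul_le_of_abs_le_one hη ha) i
    linarith [abs_nonneg (partialSum (η * a) i : ℝ)]
  have h_pos : (0 : ℝ) < i :=
    pos_of_mul_pos_left ((add_pos_of_pos_of_nonneg one_pos (abs_nonneg t)).trans_le hi) hd.le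
  have h_half : (i : ℝ) < halfScale i := mod_cast lt_halfScale i
  refine le_of_mul_le_mul_left ?_ h_pos
  calc i * |(partialSum (η * dirZ) i : ℝ) - t * partialSum (η * dirX) i|
      ≤ i * (|(partialSum (η * dirZ) i : ℝ)| + |t| * |(partialSum (η * dirX) i : ℝ)|) := by
        rw [← abs_mul]
        gcongr
        exact abs_sub _ _
    _ = i * |(partialSum (η * dirZ) i : ℝ)| + |t| * (i * |(partialSum (η * dirX) i : ℝ)|) := by
        ring
    _ ≤ halfScale i + |t| * halfScale i := by
        gcongr
        exacts [h_sum abs_dirZ_le, h_sum abs_dirX_le]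
    _ = (1 + |t|) * halfScale i := by ring
    _ ≤ i * d * halfScale i := mul_le_mul_of_nonneg_right hi (h_pos.trans h_half).le
    _ = i * (d * halfScale i) := by ring

theorem one_le_abs_sub_of_signedStep_ne_one {η : ℕ → ℤ} (hη : ∀ i, |η i| ≤ 1) {t d : ℝ}
    (hd : 0 < d) (h_dir : ∀ i, d ≤ |dirZ i - t * dirX i|) {N : ℕ} (hN : 1 + |t| ≤ N * d)
    (hη₀ : ∀ i < N, η i = 0) {n : ℕ} (h : signedStep n η ≠ 1) :
    1 ≤ |((H3Z.coords (signedStep n η)).z : ℝ) - t * (H3Z.coords (signedStep n η)).x| := by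
  obtain ⟨i, hi, h_eq⟩ := exists_leading_index h
  have hNi : 1 + |t| ≤ i * d := by
    have : (N : ℝ) ≤ i := mod_cast not_lt.1 fun h_lt => hi (hη₀ i h_lt)
    nlinarith
  have h_half : (i : ℝ) < halfScale i := mod_cast lt_halfScale i
  have h_earlier := abs_partialSum_dirZ_sub_le hη hd hNi
  have h_leading : 2 * (d * halfScale i) ≤ |scale i * (η i * (dirZ i - t * dirX i))| := by
    have h_η : |(η i : ℝ)| = 1 := mod_cast (hη i).antisymm (Int.one_le_abs hi)
    have h_scale : |(scale i : ℝ)| = 2 * halfScale i := by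
      rw [← Int.cast_abs, abs_of_pos (scale_pos i), scale_eq]
      push_cast
      rfl
    rw [abs_mul, abs_mul, h_η, h_scale]
    nlinarith [h_dir i]
  have h_split : ((H3Z.coords (signedStep n η)).z : ℝ) - t * (H3Z.coords (signedStep n η)).x =
      scale i * (η i * (dirZ i - t * dirX i)) +
        (partialSum (η * dirZ) i - t * partialSum (η * dirX) i) := by
    simp only [h_eq, coords_signedStep, partialSum_succ, Pi.mul_apply]
    push_cast
    ring
  calc 1 ≤ d * halfScale i := by nlinarith [abs_nonneg t]
    _ ≤ |scale i * (η i * (dirZ i - t * dirX i))| -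
        |(partialSum (η * dirZ) i : ℝ) - t * partialSum (η * dirX) i| := by linarith
    _ ≤ _ := by rw [h_split]; exact abs_sub_abs_le_abs_add _ _

theorem exists_smul_point_eq_of_measure_base_inter_pos {n : ℕ} {γ : H3Z}
    (h : 0 < measure (base n ∩ γ • base n)) :
    ∃ x ∈ zeroBelow n, ∃ y ∈ zeroBelow n, γ • point x = point y := by
  obtain ⟨_, ⟨y, hy, rfl⟩, _, ⟨x, hx, rfl⟩, hxy⟩ := nonempty_of_measure_ne_zero h.ne'
  exact ⟨x, hx, y, hy, hxy⟩

theorem not_isRecurrentAlong_mk {m : MetricSpace H3R} (hm : IsRightInvariantMetric m) {a c : ℝ}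
    (h : h3.of a 1 c ≠ 0) : ¬ IsRecurrentAlong m measure (.mk ℝ (h3.of a 1 c) h) := by
  intro h_rec
  obtain ⟨ε, hε, h_near⟩ := exists_forall_dist_lt_eq_one hm h
  obtain ⟨γ, hγ, g, hg, h_dist, h_pos⟩ :=
    h_rec ε hε (base 0) (measurableSet_base 0) (measure_base_pos 0)
  obtain ⟨x, -, y, -, hxy⟩ := exists_smul_point_eq_of_measure_base_inter_pos h_pos
  exact hγ (h_near γ (coords_y_eq_zero_of_smul_point_eq hxy) g hg h_dist)

theorem exists_le_abs_dirZ_sub_mul_dirX {t : ℝ} (ht : ∀ l : ℤ, t ≠ l) :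
    ∃ d > 0, ∀ i, d ≤ |dirZ i - t * dirX i| := by
  refine ⟨min 1 |t - round t|, lt_min one_pos (abs_pos.2 (sub_ne_zero.2 (ht _))), fun i => ?_⟩
  obtain h | ⟨l, h⟩ := direction_cases i
  · simp [dirX, dirZ, h]
  · simp only [dirX, dirZ, h, Int.cast_one, mul_one]
    exact (min_le_right _ _).trans ((round_le t l).trans (abs_sub_comm _ _).le)

theorem not_isRecurrentAlong_thetaLine {m : MetricSpace H3R} (hm : IsRightInvariantMetric m)
    {t : ℝ} (ht : ∀ l : ℤ, t ≠ l) : ¬ IsRecurrentAlong m measure (thetaLine t) := by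
  intro h_rec
  obtain ⟨d, hd, h_dir⟩ := exists_le_abs_dirZ_sub_mul_dirX ht
  obtain ⟨N, hN⟩ := exists_nat_ge ((1 + |t|) / d)
  obtain ⟨ε, hε, h_near⟩ := exists_forall_dist_lt_abs_sub_lt_one hm t
  obtain ⟨γ, hγ, g, hg, h_dist, h_pos⟩ :=
    h_rec ε hε (base N) (measurableSet_base N) (measure_base_pos N)
  obtain ⟨x, hx, y, hy, hxy⟩ := exists_smul_point_eq_of_measure_base_inter_pos h_pos
  obtain ⟨n, rfl⟩ := (eventually_eq_signedStep_of_smul_point_eq hxy).exists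
  refine (h_near _ g hg h_dist).not_ge (one_le_abs_sub_of_signedStep_ne_one (abs_digit_sub_le x y)
    hd h_dir ((div_le_iff₀ hd).1 hN) (fun i hi => ?_) hγ)
  rw [Pi.sub_apply, digit_of_eq_zero (hx i hi), digit_of_eq_zero (hy i hi), sub_zero]

theorem recurrentLines_measure {m : MetricSpace H3R} (hm : IsRightInvariantMetric m) :
    recurrentLines m measure = (Set.range fun l : ℤ => thetaLine l) ∪ {thetaInf} := by
  refine Set.Subset.antisymm (fun θ hθ => ?_) ?_
  · obtain ⟨a, c, rfl⟩ | ⟨t, rfl⟩ | rfl := line_cases θ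
    · exact (not_isRecurrentAlong_mk hm _ hθ).elim
    · by_contra h_mem
      exact not_isRecurrentAlong_thetaLine hm
        (fun l hl => h_mem (.inl ⟨l, congrArg thetaLine hl.symm⟩)) hθ
    · exact .inr rfl
  · rintro _ (⟨l, rfl⟩ | rfl)
    · exact isRecurrentAlong_thetaLine m l
    · exact isRecurrentAlong_thetaInf m

theorem not_isEvenlyRecurrentAlong_thetaLine {m : MetricSpace H3R}
    (hm : IsRightInvariantMetric m) (t : ℝ) :
    ¬ IsEvenlyRecurrentAlong m measure (thetaLine t) := by
  intro h
  refine not_isRecurrentAlong_thetaLine hm (t := 1 / 2) (fun l hl => ?_)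
    (h _ (thetaLine_mem_orbit t (1 / 2)))
  have h_one : 2 * l = 1 := by
    rify
    linarith
  omega

theorem evenlyRecurrentLines_measure {m : MetricSpace H3R} (hm : IsRightInvariantMetric m) :
    evenlyRecurrentLines m measure = {thetaInf} := by
  refine Set.Subset.antisymm (fun θ hθ => ?_) ?_
  · have h_rec : θ ∈ recurrentLines m measure := hθ θ (MulAction.mem_orbit_self θ)
    rw [recurrentLines_measure hm] at h_rec
    obtain ⟨l, rfl⟩ | h := h_rec
    · exact (not_isEvenlyRecurrentAlong_thetaLine hm l hθ).elim
    · exact h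
  · rintro _ rfl _ ⟨g, rfl⟩
    dsimp only
    rw [smul_thetaInf]
    exact isRecurrentAlong_thetaInf m

end Heisenberg

end

theorem theorem6p2 :
    ∃ (X : Type) (_ : MeasurableSpace X) (_ : StandardBorelSpace X) (_ : MulAction H3Z X)
      (μ : Measure X),
      SigmaFinite μ ∧ μ Set.univ = ∞ ∧
      (∀ γ : H3Z, MeasurePreserving (fun x : X => γ • x) μ μ) ∧
      (∀ γ : H3Z, γ ≠ 1 → ∀ x : X, γ • x ≠ x) ∧
      IsRankOne H3Z μ ∧
      ∀ m : MetricSpace H3R, IsRightInvariantMetric m →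
        recurrentLines m μ = (Set.range fun l : ℤ => thetaLine l) ∪ {thetaInf} ∧
        evenlyRecurrentLines m μ = {thetaInf} ∧
        evenlyRecurrentLines m μ ≠ recurrentLines m μ := by
  refine ⟨Heis ℤ_[2], inferInstance, inferInstance, inferInstance, Heisenberg.measure,
    inferInstance, Heisenberg.measure_univ, fun γ => measurePreserving_smul γ Heisenberg.measure,
    fun γ hγ => smul_ne_self hγ, isRankOne_measure, fun m hm =>
      ⟨recurrentLines_measure hm, evenlyRecurrentLines_measure hm, fun h => ?_⟩⟩
  have h_zero : thetaLine (0 : ℤ) ∈ recurrentLines m Heisenberg.measure :=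
    isRecurrentAlong_thetaLine m 0
  rw [← h] at h_zero
  exact not_isEvenlyRecurrentAlong_thetaLine hm _ h_zero
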